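/- Consider a complete family of $L$-loop Feynman integrals with $E-1$ independent external momenta $p_1,\dots,p_{E-1}$ and $p$ propagators, with squared masses $m_a^2>0$ and momenta $q_a=\sum_{j=1}^{L}\alpha_{aj}k_j+\sum_{r=1}^{E-1}\beta_{ar}p_r$, $\alpha_{aj},\beta_{ar}\in\{-1,0,1\}$: $$I(x;\nu;D)=\int\Big(\prod_{j=1}^{L}e^{\gamma_E\epsilon}\frac{\mathrm d^Dk_j}{i\pi^{D/2}}\Big)\prod_{a=1}^{p}\frac{1}{(m_a^2-q_a^2-i0)^{\nu_a}},\qquad \nu\in\mathbb Z^p,\quad D=D_0-2\epsilon,\quad D_0\in\mathbb N,\ \epsilon\in\mathbb C .$$ Here $x$ consists of the real products $p_r\cdot p_s$ and the $m_a^2$. Complete means that the affine map from the products $k_i\cdot k_j$ $(i\le j)$ and $k_i\cdot p_r$ to the inverse propagators $z_a=m_a^2-q_a^2$ is invertible. The integrals are understood in dimensional regularisation: for $\eta>0$ replace $m_a^2$ by $m_a^2-i\eta$, define the integral for $\operatorname{Re}D\ll0$ by its Schwinger representation (with exponents $\nu_a\le0$ by analytic continuation in $\nu_a$), continue it meromorphically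 in $D\in\mathbb C$, evaluate at a $D$ which is not a pole, and let $\eta\to0^+$. The integral $I(x;\nu;D)$ exists if there is no pole at $D$ for small $\eta$ and the limit is finite. Let $K=L+E-1$, let $G(p_1,\dots,p_{E-1})=\det(p_r\cdot p_s)$ (equal to $1$ if $E=1$), and let the Baikov polynomial $\mathcal B(z_1,\dots,z_p)$ be the Gram determinant $G(k_1,\dots,k_L,p_1,\dots,p_{E-1})$ written as a polynomial in the $z_a$. Let $(y)_L=y(y+1)\cdots(y+L-1)$, and let $b_a$ be the operator that lowers the exponent $\nu_a$ by one, so that $b_a^{c}\,I(x;\nu;D)=I(x;\nu_1,\dots,\nu_a-c,\dots,\nu_p;D)$. Assume $G(p_1,\dots,p_{E-1})\ne0$ and $(D-K+1)_L\neq0$, and let $\nu\in\mathbb Z^p$ be such that $I(x;\nu';D)$ exists for every $\nu'\in\mathbb Z^p$ with $\nu'\le\nu$ componentwise. Then $I(x;\nu;D+2)$ (that is, $D_0$ is replaced by $D_0+2$ with the same $\epsilon$) exists, and $$I(x;\nu;D+2)=\frac{(-2)^L}{G(p_1,\dots,p_{E-1})\,(D-K+1)_L}\;\mathcal B(b_1,\dots,b_p)\,I(x;\nu;D).$$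 -/

import Mathlib

open Filter Topology MeasureTheory

noncomputable section

namespace FeynmanIntegral

/-! ### Complete families of propagators -/

/-- Labels of the independent dot products that involve at least one of the `L` loop momenta:
`inl s(i, j)` stands for `k_i · k_j`, and `inr (i, r)` stands for `k_i · p_r`, where
`p_0, …, p_{n-1}` are the `n = E - 1` independent external momenta. -/
abbrev DotIdx (L n : ℕ) : Type := Sym2 (Fin L) ⊕ (Fin L × Fin n)

/-- For `q_a = ∑ j, α a j • k_j + ∑ r, β a r • p_r`, the part of `q_a ^ 2` that depends on the loop
momenta, as a linear function of the dot products: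
`∑ i j, α a i * α a j * (k_i · k_j) + 2 * ∑ i r, α a i * β a r * (k_i · p_r)`. -/
def dotMap {L n p : ℕ} (α : Fin p → Fin L → ℤ) (β : Fin p → Fin n → ℤ) :
    (DotIdx L n → ℝ) →ₗ[ℝ] (Fin p → ℝ) :=
  LinearMap.pi fun a =>
    (∑ i, ∑ j, ((α a i * α a j : ℤ) : ℝ) • LinearMap.proj (Sum.inl s(i, j))) +
      ∑ i, ∑ r, ((2 * (α a i * β a r) : ℤ) : ℝ) • LinearMap.proj (Sum.inr (i, r))

/-- A complete family of propagators with `L` loop momenta, `n = E - 1` independent external momenta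
and `p` propagator momenta `q_a = ∑ j, α a j • k_j + ∑ r, β a r • p_r`: the change of variables
from the dot products to the inverse propagators `z_a = m_a ^ 2 - q_a ^ 2` is invertible. -/
structure CompleteFamily (L n p : ℕ) where
  α : Fin p → Fin L → ℤ
  β : Fin p → Fin n → ℤ
  α_mem : ∀ a j, α a j = -1 ∨ α a j = 0 ∨ α a j = 1
  β_mem : ∀ a r, β a r = -1 ∨ β a r = 0 ∨ β a r = 1
  complete : Function.Bijective (dotMap α β)

namespace CompleteFamily

variable {L n p : ℕ} (F : CompleteFamily L n p)

/-! ### Schwinger representation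

Here `S r s = p_r · p_s` are the external dot products, and `M a` is the squared mass of the
propagator `a` (complex, since it absorbs the Feynman prescription `m_a ^ 2 - iη`). -/

/-- `(∑ r, β a r • p_r) ^ 2`, the part of `q_a ^ 2` that does not depend on the loop momenta. -/
def extSq (S : Matrix (Fin n) (Fin n) ℝ) (a : Fin p) : ℝ :=
  ∑ r, ∑ s, (F.β a r : ℝ) * F.β a s * S r s

/-- The matrix of the quadratic form `∑ a, s_a * q_a ^ 2` in the loop momenta. -/
def quadMatrix (s : Fin p → ℝ) : Matrix (Fin L) (Fin L) ℝ :=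
  Matrix.of fun i j => ∑ a, s a * F.α a i * F.α a j

/-- The coefficients of `∑ a, s_a * q_a ^ 2` at the products `2 * (k_i · p_r)`. -/
def linMatrix (s : Fin p → ℝ) : Matrix (Fin L) (Fin n) ℝ :=
  Matrix.of fun i r => ∑ a, s a * F.α a i * F.β a r

/-- The first Symanzik polynomial `𝒰`. -/
def symanzikU (s : Fin p → ℝ) : ℝ := (F.quadMatrix s).det

/-- The mass-independent part of the second Symanzik polynomial. -/
def symanzikFtilde (S : Matrix (Fin n) (Fin n) ℝ) (s : Fin p → ℝ) : ℝ :=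
  ((F.quadMatrix s).adjugate * (F.linMatrix s * S * (F.linMatrix s).transpose)).trace -
    F.symanzikU s * ∑ a, s a * F.extSq S a

/-- The second Symanzik polynomial `ℱ = 𝒰 * ∑ a, M_a * s_a + ℱ̃`. -/
def symanzikF (S : Matrix (Fin n) (Fin n) ℝ) (M : Fin p → ℂ) (s : Fin p → ℝ) : ℂ :=
  F.symanzikU s * ∑ a, M a * s a + F.symanzikFtilde S s

/-- `𝒰 ^ (-D/2) * exp (-ℱ / 𝒰)` at the Schwinger parameters `i * s_a`, `s_a > 0`, up to the
constant factor `i ^ (-L * D / 2)`. -/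
def schwingerKernel (S : Matrix (Fin n) (Fin n) ℝ) (M : Fin p → ℂ) (D : ℂ) (s : Fin p → ℝ) : ℂ :=
  (F.symanzikU s : ℂ) ^ (-D / 2) *
    Complex.exp (-Complex.I * (F.symanzikF S M s / F.symanzikU s))

end CompleteFamily

/-- The partial derivative with respect to the `a`-th coordinate. -/
def partialDeriv {p : ℕ} (a : Fin p) (f : (Fin p → ℝ) → ℂ) : (Fin p → ℝ) → ℂ :=
  fun s => deriv (fun t => f (Function.update s a t)) (s a)

/-- The mixed partial derivative of order `m a` in the `a`-th coordinate, for all `a`. -/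
def mixedPartial {p : ℕ} (m : Fin p → ℕ) (f : (Fin p → ℝ) → ℂ) : (Fin p → ℝ) → ℂ :=
  (List.finRange p).foldr (fun a g => (partialDeriv a)^[m a] g) f

/-- The open orthant of Schwinger parameters. -/
def orthant (p : ℕ) : Set (Fin p → ℝ) := {s | ∀ a, 0 < s a}

namespace CompleteFamily

variable {L n p : ℕ} (F : CompleteFamily L n p)

/-- The integrand of the Schwinger representation for integer exponents. For `ν a ≥ 1`, the
propagator `a` contributes the usual density `s_a ^ (ν_a - 1) / Γ(ν_a)`. For `ν a ≤ 0` this density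
is understood, as always, by analytic continuation in the exponent, that is, as
`(d/ds_a) ^ (1 - ν_a)` of the unit step in the sense of distributions: the derivatives are moved to
the kernel. -/
def schwingerIntegrand (S : Matrix (Fin n) (Fin n) ℝ) (M : Fin p → ℂ) (ν : Fin p → ℤ) (D : ℂ)
    (s : Fin p → ℝ) : ℂ :=
  (∏ a, ((s a : ℂ) ^ (ν a - 1).toNat / ((ν a - 1).toNat.factorial : ℂ) *
      (-1) ^ (1 - ν a).toNat)) *
    mixedPartial (fun a => (1 - ν a).toNat) (F.schwingerKernel S M D) s

/-- The Schwinger representation of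
`∫ ∏ j, (d^D k_j / (i π ^ (D/2))) * ∏ a, (M_a - q_a ^ 2) ^ (-ν_a)`, `Im M_a < 0`. It comes from
`X ^ (-ν) = i ^ ν / Γ(ν) * ∫_0^∞ s ^ (ν - 1) * exp (-i s X) ds`, `Im X < 0`, that is, the Schwinger
parameters run along the positive imaginary axis, as required in Minkowski kinematics. The first
factor is `i ^ (-L * D / 2)`. -/
def schwingerIntegral (S : Matrix (Fin n) (Fin n) ℝ) (M : Fin p → ℂ) (ν : Fin p → ℤ) (D : ℂ) : ℂ :=
  Complex.exp (-(Real.pi * Complex.I * L * D / 4)) * (∏ a, Complex.I ^ (ν a)) *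
    ∫ s in orthant p, F.schwingerIntegrand S M ν D s

/-- `J` is the dimensionally regularised integral with squared masses `M a`, `Im (M a) < 0`, as a
function of `D`: it is meromorphic on `ℂ`, and it is given by the absolutely convergent Schwinger
representation when the real part of `D` is sufficiently negative. -/
def IsDimReg (S : Matrix (Fin n) (Fin n) ℝ) (M : Fin p → ℂ) (ν : Fin p → ℤ) (J : ℂ → ℂ) : Prop :=
  Meromorphic J ∧ ∃ R : ℝ, ∀ D : ℂ, D.re < R →
    IntegrableOn (F.schwingerIntegrand S M ν D) (orthant p) ∧ J D = F.schwingerIntegral S M ν D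

/-- `I(x; ν; D₀ - 2ε) = v`: the propagator denominators are `m_a ^ 2 - q_a ^ 2 - iη` with `η → 0⁺`,
and for each small `η` the integral is dimensionally regularised and has no pole at
`D = D₀ - 2ε`; every loop carries the normalisation `e ^ (γ ε)`. -/
def HasValue (S : Matrix (Fin n) (Fin n) ℝ) (m2 : Fin p → ℝ) (ν : Fin p → ℤ) (D₀ : ℕ) (ε : ℂ)
    (v : ℂ) : Prop :=
  ∃ J : ℝ → ℂ → ℂ,
    (∀ᶠ η : ℝ in 𝓝[>] 0, F.IsDimReg S (fun a => m2 a - Complex.I * η) ν (J η) ∧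
      AnalyticAt ℂ (J η) (D₀ - 2 * ε)) ∧
    Tendsto (fun η : ℝ =>
      Complex.exp (Real.eulerMascheroniConstant * L * ε) * J η (D₀ - 2 * ε)) (𝓝[>] 0) (𝓝 v)

/-! ### The Baikov polynomial -/

/-- The dot product with label `e`, as a polynomial (of degree one) in the inverse propagators
`z_a = M_a - q_a ^ 2`: the inverse of `dotMap` applied to the vector `M_a - extSq a - z_a`. -/
def dotPoly (S : Matrix (Fin n) (Fin n) ℝ) (M : Fin p → ℂ) (e : DotIdx L n) :
    MvPolynomial (Fin p) ℂ :=
  ∑ a, MvPolynomial.C (((LinearEquiv.ofBijective (dotMap F.α F.β) F.complete).symm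
      (Pi.single a 1) e : ℝ) : ℂ) *
    (MvPolynomial.C (M a - F.extSq S a) - MvPolynomial.X a)

/-- The Baikov polynomial: the Gram determinant `G(k_1, …, k_L, p_1, …, p_{E-1})`, as a polynomial in
the inverse propagators. -/
def baikovPoly (S : Matrix (Fin n) (Fin n) ℝ) (M : Fin p → ℂ) : MvPolynomial (Fin p) ℂ :=
  (Matrix.fromBlocks
    (Matrix.of fun i j : Fin L => F.dotPoly S M (Sum.inl s(i, j)))
    (Matrix.of fun (i : Fin L) (r : Fin n) => F.dotPoly S M (Sum.inr (i, r)))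
    (Matrix.of fun (r : Fin n) (i : Fin L) => F.dotPoly S M (Sum.inr (i, r)))
    (S.map fun x : ℝ => (MvPolynomial.C (x : ℂ) : MvPolynomial (Fin p) ℂ))).det

end CompleteFamily

/-- `B(b_1, …, b_p) I`, evaluated at `ν`, where `b_a` lowers the exponent `ν_a` by one. -/
def applyLowering {p : ℕ} (B : MvPolynomial (Fin p) ℂ) (I : (Fin p → ℤ) → ℂ) (ν : Fin p → ℤ) : ℂ :=
  ∑ m ∈ B.support, B.coeff m * I (fun a => ν a - (m a : ℤ))

end FeynmanIntegral


/-!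
The Schwinger parameters `s_a` are dual to the inverse propagators: lowering `ν_a` acts on the
kernel `𝒰 ^ (-D/2) * exp (-i ℱ / 𝒰)` as `i ∂ / ∂ s_a`. Since the family is complete, the
derivatives `∂ / ∂ s_a` recombine into derivatives with respect to the entries of the matrices
`A` and `B` of the quadratic form `∑ a, s_a * q_a ^ 2`, so that each dot product `k_i · k_j` or
`k_i · p_r` becomes one such derivative. The Baikov polynomial is `G(p_1, …, p_{E-1})` times the
determinant of the Schur complement of the external Gram matrix. In the Schur complement the
momentum-dependent terms cancel, and what remains is the determinant of the derivatives with
respect to the entries of the symmetric matrix `A`, acting on a power of `𝒰 = det A`. The Cayley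
identity evaluates it to a Pochhammer symbol times the kernel divided by `𝒰`, which is the kernel
in dimension `D + 2`.

For `Re D ≪ 0` the kernel and its derivatives decay exponentially, which yields the recurrence by
integration by parts; every boundary term carries a positive power of a Schwinger parameter, hence
vanishes. Both sides are meromorphic in `D`, and the limit `η → 0⁺` passes through the finitely many
coefficients of the Baikov polynomial, which are continuous in `η`.
-/

noncomputable section

namespace FeynmanIntegral

open scoped Matrix

section CommutingFamily

variable {σ k A : Type*} [CommRing k] [Ring A] [Algebra k A] (T : σ → A)
  (hT : ∀ a b, T a * T b = T b * T a)

open scoped IsMulCommutative in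
/-- Evaluation of a polynomial at a commuting family of elements of a noncommutative algebra. -/
def evalCommuting : MvPolynomial σ k →ₐ[k] A :=
  haveI := Algebra.isMulCommutative_adjoin k (s := Set.range T)
    (by rintro _ ⟨a, rfl⟩ _ ⟨b, rfl⟩; exact hT a b)
  (Algebra.adjoin k (Set.range T)).val.comp
    (MvPolynomial.aeval fun a => ⟨T a, Algebra.subset_adjoin ⟨a, rfl⟩⟩)

theorem evalCommuting_X (a : σ) : evalCommuting (k := k) T hT (MvPolynomial.X a) = T a := by
  simp [evalCommuting]

end CommutingFamily

section Derivations

variable {k R : Type*} [CommRing k] [CommRing R] [Algebra k R] {ι : Type*}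

theorem derivation_prod [DecidableEq ι] {M : Type*} [AddCommGroup M] [Module k M] [Module R M]
    (d : Derivation k R M) (s : Finset ι) (f : ι → R) :
    d (∏ i ∈ s, f i) = ∑ i ∈ s, (∏ j ∈ s.erase i, f j) • d (f i) := by
  induction s using Finset.induction_on with
  | empty => simp
  | insert b s hb ih =>
    rw [Finset.prod_insert hb, Derivation.leibniz, ih, Finset.sum_insert hb,
      Finset.erase_insert hb, Finset.smul_sum, add_comm]
    congr 1
    refine Finset.sum_congr rfl fun a ha => ?_
    rw [Finset.erase_insert_of_ne (ne_of_mem_of_not_mem ha hb).symm,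
      Finset.prod_insert (fun h => hb (Finset.mem_of_mem_erase h)), smul_smul]

theorem derivation_map_mul {l m n : Type*} [Fintype m] (d : Derivation k R R) (X : Matrix l m R)
    (Y : Matrix m n R) : (X * Y).map d = X.map d * Y + X * Y.map d := by
  ext i j
  simp [Matrix.mul_apply, ← Finset.sum_add_distrib, mul_comm, add_comm]

variable [Fintype ι] [DecidableEq ι]

theorem derivation_map_inverse (d : Derivation k R R) {A G : Matrix ι ι R} (hAG : A * G = 1) :
    G.map d = -(G * A.map d * G) := by
  have hGA : G * A = 1 := mul_eq_one_comm.mp hAG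
  have hone : (1 : Matrix ι ι R).map d = 0 := by
    ext i j
    by_cases h : i = j <;> simp [h]
  have hmul : A.map d * G + A * G.map d = 0 := by rw [← derivation_map_mul, hAG, hone]
  calc G.map d = G * (A * G.map d) := by rw [← Matrix.mul_assoc, hGA, Matrix.one_mul]
    _ = -(G * A.map d * G) := by
      rw [eq_neg_of_add_eq_zero_right hmul, Matrix.mul_neg, Matrix.mul_assoc]

theorem derivation_det_eq_sum_updateRow (d : Derivation k R R) (N : Matrix ι ι R) :
    d N.det = ∑ a, (N.updateRow a fun b => d (N a b)).det := by
  have hdet (M : Matrix ι ι R) :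
      M.det = ∑ σ : Equiv.Perm ι, Equiv.Perm.sign σ • ∏ i, M i (σ i) := by
    rw [← Matrix.det_transpose, Matrix.det_apply]; rfl
  simp_rw [hdet, map_sum, Units.smul_def, map_zsmul]
  rw [Finset.sum_comm]
  refine Finset.sum_congr rfl fun σ _ => ?_
  rw [← Finset.smul_sum, derivation_prod]
  congr 1
  refine Finset.sum_congr rfl fun a _ => ?_
  rw [← Finset.mul_prod_erase _ _ (Finset.mem_univ a), Matrix.updateRow_self, smul_eq_mul, mul_comm]
  congr 1
  refine Finset.prod_congr rfl fun i hi => ?_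
  rw [Matrix.updateRow_ne (Finset.ne_of_mem_erase hi)]

omit [Algebra k R] in
theorem det_updateRow_eq_sum (M : Matrix ι ι R) (a : ι) (v : ι → R) :
    (M.updateRow a v).det = ∑ c, v c * (M.updateRow a (Pi.single c 1)).det := by
  rw [Matrix.det_eq_sum_mul_adjugate_row _ a]
  simp [Matrix.adjugate_apply]

theorem derivation_det (d : Derivation k R R) (N : Matrix ι ι R) :
    d N.det = (N.map d * N.adjugate).trace := by
  rw [derivation_det_eq_sum_updateRow]
  refine Finset.sum_congr rfl fun a _ => ?_
  rw [det_updateRow_eq_sum]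
  simp_rw [← Matrix.adjugate_apply]
  rfl

theorem det_mul_derivation_det (d : Derivation k R R) {A G : Matrix ι ι R} (hAG : A * G = 1) :
    G.det * d A.det = (A.map d * G).trace := by
  have hdet : G.det * A.det = 1 := by rw [mul_comm, ← Matrix.det_mul, hAG, Matrix.det_one]
  have hadj : G.det • A.adjugate = G := by
    calc G.det • A.adjugate = G.det • (A.adjugate * (A * G)) := by rw [hAG, Matrix.mul_one]
      _ = G := by
        rw [← Matrix.mul_assoc, Matrix.adjugate_mul, Matrix.smul_mul, Matrix.one_mul, smul_smul,
          hdet, one_smul]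
  rw [derivation_det, ← smul_eq_mul, ← Matrix.trace_smul, ← Matrix.mul_smul, hadj]

omit [DecidableEq ι] in
theorem derivation_trace (d : Derivation k R R) (N : Matrix ι ι R) :
    d N.trace = (N.map d).trace := by
  simp [Matrix.trace]

end Derivations

section Trace

variable {R : Type*} [CommRing R] {l m : Type*} [Fintype l] [Fintype m]

theorem trace_mul_mul_transpose_comm {G : Matrix l l R} {S : Matrix m m R} (hG : G.IsSymm)
    (hS : S.IsSymm) (X Y : Matrix l m R) :
    (G * (X * S * Yᵀ)).trace = (G * (Y * S * Xᵀ)).trace := by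
  rw [← Matrix.trace_transpose, Matrix.trace_mul_comm]
  simp only [Matrix.transpose_mul, hG.eq, hS.eq, Matrix.transpose_transpose, Matrix.mul_assoc]

theorem trace_symmSingle_mul [DecidableEq l] [Algebra ℂ R] (W : Matrix l l R) (hW : W.IsSymm)
    (i j : l) :
    (((2⁻¹ : ℂ) • (Matrix.single i j 1 + Matrix.single j i 1 : Matrix l l R)) * W).trace =
      W i j := by
  rw [Matrix.smul_mul, Matrix.trace_smul, Matrix.add_mul, Matrix.trace_add,
    Matrix.trace_single_mul, Matrix.trace_single_mul, one_smul, one_smul, hW.apply]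
  module

theorem mul_single_mul_apply {k o : Type*} [DecidableEq l] [DecidableEq m] (X : Matrix k l R)
    (Y : Matrix m o R) (i : l) (j : m) (r : k) (s : o) :
    (X * Matrix.single i j (1 : R) * Y) r s = X r i * Y j s := by
  simp [Matrix.mul_apply, Matrix.single_apply, ite_and]

end Trace

theorem algebraMap_I_mul_self {R : Type*} [CommRing R] [Algebra ℂ R] :
    algebraMap ℂ R Complex.I * algebraMap ℂ R Complex.I = -1 := by
  rw [← map_mul, Complex.I_mul_I, map_neg, map_one]

section CayleyIdentity

variable {R : Type*} [CommRing R]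

theorem sum_symm_mul_alternating {ι : Type*} [Fintype ι] (H X : ι → ι → R)
    (hH : ∀ i j, H i j = H j i) (hdiag : ∀ i, X i i = 0) (hX : ∀ i j, X i j = -X j i) :
    ∑ i, ∑ j, H i j * X i j = 0 := by
  classical
  rw [← Finset.sum_product']
  refine Finset.sum_involution (fun q _ => q.swap) (fun q _ => ?_) (fun q _ hq heq => hq ?_)
    (fun _ _ => by simp) fun _ _ => Prod.swap_swap _
  · simp only [Prod.fst_swap, Prod.snd_swap]
    rw [hH q.1 q.2, hX q.1 q.2, mul_neg, neg_add_cancel]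
  · have hq' : q.2 = q.1 := congrArg Prod.fst heq
    rw [hq', hdiag, mul_zero]

theorem det_updateRow_updateRow_self {ι : Type*} [DecidableEq ι] [Fintype ι] (M : Matrix ι ι R)
    {a b : ι} (hab : a ≠ b) (u : ι → R) : ((M.updateRow a u).updateRow b u).det = 0 :=
  Matrix.det_zero_of_row_eq hab (by simp [Matrix.updateRow_ne hab])

theorem det_updateRow_updateRow_swap {ι : Type*} [DecidableEq ι] [Fintype ι] (M : Matrix ι ι R)
    {a b : ι} (hab : a ≠ b) (u v : ι → R) :
    ((M.updateRow a u).updateRow b v).det = -((M.updateRow a v).updateRow b u).det := by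
  have h := det_updateRow_updateRow_self M hab (u + v)
  rw [Matrix.det_updateRow_add, Matrix.updateRow_comm _ hab, Matrix.updateRow_comm _ hab,
    Matrix.det_updateRow_add, Matrix.det_updateRow_add, Matrix.updateRow_comm _ hab.symm,
    Matrix.updateRow_comm _ hab.symm, Matrix.updateRow_comm _ hab.symm,
    Matrix.updateRow_comm _ hab.symm, det_updateRow_updateRow_self M hab,
    det_updateRow_updateRow_self M hab, zero_add, add_zero, add_comm] at h
  exact eq_neg_of_add_eq_zero_left h

theorem det_minor_updateRow {m : ℕ} (Q : Matrix (Fin (m + 1)) (Fin (m + 1)) R) (a : Fin m)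
    (b : Fin (m + 1)) (v : Fin (m + 1) → R) :
    (-1) ^ (b : ℕ) * ((Q.submatrix Fin.succ b.succAbove).updateRow a (v ∘ b.succAbove)).det =
      ((Q.updateRow a.succ v).updateRow 0 (Pi.single b 1)).det := by
  rw [← Matrix.adjugate_apply, Matrix.adjugate_fin_succ_eq_det_submatrix]
  simp only [Fin.val_zero, zero_add]
  congr 2
  ext i j
  by_cases hi : i = a
  · subst hi; simp
  · simp [Matrix.updateRow_ne hi, Matrix.updateRow_ne (fun h => hi (Fin.succ_injective _ h))]

variable {k : Type*} [CommRing k] [Algebra k R] {ι : Type*} (G : Matrix ι ι R)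
  (δ : ι → ι → Derivation k R R)
  (hδ : ∀ i j r s, 2 * δ i j (G r s) = -(G r i * G j s + G r j * G i s))

include hδ

theorem two_mul_det_minor_updateRow_deriv {m : ℕ} (i j : Fin (m + 1) → ι) (b : Fin (m + 1))
    (a : Fin m) :
    2 * ((-1) ^ (b : ℕ) * (((G.submatrix i j).submatrix Fin.succ b.succAbove).updateRow a
      fun c => δ (i 0) (j b) ((G.submatrix i j).submatrix Fin.succ b.succAbove a c)).det) =
    G (i a.succ) (j b) * (G.submatrix i j).adjugate b a.succ -
      G (i a.succ) (i 0) * ∑ c, G (j b) (j c) *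
        (((G.submatrix i j).updateRow a.succ (Pi.single c 1)).updateRow 0 (Pi.single b 1)).det := by
  set Q := G.submatrix i j with hQ
  have hrow : (2 : R) • (fun c => δ (i 0) (j b) (Q.submatrix Fin.succ b.succAbove a c)) =
      (-G (i a.succ) (i 0)) • ((fun c => G (j b) (j c)) ∘ b.succAbove) +
        (-Q a.succ b) • (Q 0 ∘ b.succAbove) := by
    ext c
    simp only [Pi.smul_apply, smul_eq_mul, hQ, Matrix.submatrix_apply, hδ, Pi.add_apply,
      Function.comp_apply]
    ring
  have hfirst : ((Q.updateRow a.succ fun c => G (j b) (j c)).updateRow 0 (Pi.single b 1)).det =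
      ∑ c, G (j b) (j c) *
        ((Q.updateRow a.succ (Pi.single c 1)).updateRow 0 (Pi.single b 1)).det := by
    rw [Matrix.updateRow_comm _ (Fin.succ_ne_zero a), det_updateRow_eq_sum]
    simp_rw [Matrix.updateRow_comm Q (Fin.succ_ne_zero a).symm]
  have hsecond : ((Q.updateRow a.succ (Q 0)).updateRow 0 (Pi.single b 1)).det =
      -Q.adjugate b a.succ := by
    rw [det_updateRow_updateRow_swap _ (Fin.succ_ne_zero a),
      Matrix.updateRow_comm _ (Fin.succ_ne_zero a), Matrix.updateRow_eq_self Q 0,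
      Matrix.adjugate_apply]
  rw [mul_left_comm, ← Matrix.det_updateRow_smul, hrow, Matrix.det_updateRow_add,
    Matrix.det_updateRow_smul, Matrix.det_updateRow_smul, mul_add, mul_left_comm,
    det_minor_updateRow, hfirst, mul_left_comm, det_minor_updateRow, hsecond]
  simp only [hQ, Matrix.submatrix_apply]
  ring

/-- The row expansion behind the Cayley identity for symmetric matrices: `G` is to be thought of as
the inverse of a symmetric matrix of indeterminates, and `δ i j` as the derivative with respect to
its `(i, j)` entry, the off-diagonal entries being varied symmetrically with weight `1 / 2`. -/
theorem two_mul_sum_deriv_minor (hG : G.IsSymm) {m : ℕ} (i j : Fin (m + 1) → ι) :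
    2 * ∑ b : Fin (m + 1), (-1) ^ (b : ℕ) *
        δ (i 0) (j b) (G.submatrix (i ∘ Fin.succ) (j ∘ b.succAbove)).det =
      m * (G.submatrix i j).det := by
  set Q := G.submatrix i j with hQ
  have hvanish (a : Fin m) : ∑ b, ∑ c, G (j b) (j c) *
      ((Q.updateRow a.succ (Pi.single c 1)).updateRow 0 (Pi.single b 1)).det = 0 :=
    sum_symm_mul_alternating _ _ (fun b c => hG.apply _ _)
      (fun b => det_updateRow_updateRow_self _ (Fin.succ_ne_zero a) _)
      fun b c => det_updateRow_updateRow_swap _ (Fin.succ_ne_zero a) _ _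
  have hexpand (a : Fin m) : ∑ b, G (i a.succ) (j b) * Q.adjugate b a.succ = Q.det :=
    (Matrix.det_eq_sum_mul_adjugate_row Q a.succ).symm
  have hminor (b : Fin (m + 1)) : G.submatrix (i ∘ Fin.succ) (j ∘ b.succAbove) =
      Q.submatrix Fin.succ b.succAbove := rfl
  simp_rw [hminor, derivation_det_eq_sum_updateRow, Finset.mul_sum]
  rw [Finset.sum_comm]
  simp_rw [hQ, two_mul_det_minor_updateRow_deriv G δ hδ, Finset.sum_sub_distrib,
    ← Finset.mul_sum, ← hQ, hvanish, hexpand]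
  simp

end CayleyIdentity

section DifferentialOperators

variable {σ R : Type*} [CommRing R] [Algebra ℂ R] (d : σ → Derivation ℂ R R)
  (hd : ∀ a b f, d a (d b f) = d b (d a f))

/-- The representation `X a ↦ i * d a` of polynomials by differential operators. -/
def diffOp : MvPolynomial σ ℂ →ₐ[ℂ] Module.End ℂ R :=
  evalCommuting (fun a => Complex.I • (d a : R →ₗ[ℂ] R)) fun a b => by
    ext f
    simp [hd a b]

theorem diffOp_X (a : σ) (f : R) : diffOp d hd (MvPolynomial.X a) f = Complex.I • d a f := by
  simp [diffOp, evalCommuting_X]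

theorem diffOp_C (c : ℂ) (f : R) : diffOp d hd (MvPolynomial.C c) f = c • f := by
  rw [← MvPolynomial.algebraMap_eq, AlgHom.commutes, Module.algebraMap_end_apply]

theorem diffOp_mul (P Q : MvPolynomial σ ℂ) (f : R) :
    diffOp d hd (P * Q) f = diffOp d hd P (diffOp d hd Q f) := by
  rw [map_mul, Module.End.mul_apply]

end DifferentialOperators

namespace CompleteFamily

variable {L n p : ℕ} (F : CompleteFamily L n p)

section DualBasis

/-- The coefficient of the `a`-th coordinate in the inverse of `dotMap`, at the dot product `e`. -/
def dotCoeff (e : DotIdx L n) (a : Fin p) : ℝ :=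
  (LinearEquiv.ofBijective (dotMap F.α F.β) F.complete).symm (Pi.single a 1) e

theorem sum_dotCoeff_mul_dotMap (e : DotIdx L n) (y : DotIdx L n → ℝ) :
    ∑ a, F.dotCoeff e a * dotMap F.α F.β y a = y e := by
  set T := LinearEquiv.ofBijective (dotMap F.α F.β) F.complete with hT
  have h : T.symm (∑ a, dotMap F.α F.β y a • Pi.single a (1 : ℝ)) = y := by
    rw [T.symm_apply_eq]
    ext b
    simp [hT, Pi.single_apply]
  conv_rhs => rw [← h]
  simp [map_sum, dotCoeff, hT, mul_comm]

/-- The vector of dot products that `dotMap` sends to the products `α a k * α a l`: the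
symmetrised product of the `k`-th and the `l`-th loop momentum. -/
def symmSingle {L n : ℕ} (k l : Fin L) : DotIdx L n → ℝ :=
  Sum.elim (Sym2.lift ⟨fun i j => ((if i = k ∧ j = l then 1 else 0) +
    (if i = l ∧ j = k then 1 else 0)) / 2, fun i j => by
      simp only [and_comm, add_comm]⟩) 0

theorem dotMap_symmSingle (k l : Fin L) (a : Fin p) :
    dotMap F.α F.β (symmSingle k l) a = F.α a k * F.α a l := by
  simp only [dotMap, Int.cast_mul, Int.cast_ofNat, symmSingle, ite_and, LinearMap.pi_apply,
    LinearMap.add_apply, LinearMap.coe_sum, LinearMap.coe_smul, LinearMap.coe_proj,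
    Finset.sum_apply, Pi.smul_apply, Function.eval, Sum.elim_inl, Sym2.lift_mk, smul_eq_mul,
    mul_div_assoc', mul_add, mul_ite, mul_one, mul_zero, ← Finset.sum_div, Finset.sum_add_distrib,
    Finset.sum_ite_irrel, Finset.sum_ite_eq', Finset.mem_univ, ↓reduceIte, Finset.sum_const_zero,
    Sum.elim_inr, Pi.zero_apply, add_zero]
  ring

theorem dotMap_single_inr (k : Fin L) (s : Fin n) (a : Fin p) :
    dotMap F.α F.β (Pi.single (Sum.inr (k, s)) 2⁻¹) a = F.α a k * F.β a s := by
  simp only [dotMap, Int.cast_mul, Int.cast_ofNat, LinearMap.pi_apply, LinearMap.add_apply,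
    LinearMap.coe_sum, LinearMap.coe_smul, LinearMap.coe_proj, Finset.sum_apply, Pi.smul_apply,
    Function.eval, ne_eq, reduceCtorEq, not_false_eq_true, Pi.single_eq_of_ne, smul_eq_mul,
    mul_zero, Finset.sum_const_zero, Pi.single_apply, Sum.inr.injEq, Prod.mk.injEq, ite_and,
    mul_ite, Finset.sum_ite_irrel, Finset.sum_ite_eq', Finset.mem_univ, ↓reduceIte, zero_add]
  ring

theorem sum_dotCoeff_inl_mul_loop (i j k l : Fin L) :
    ∑ a, F.dotCoeff (Sum.inl s(i, j)) a * (F.α a k * F.α a l) =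
      ((if i = k ∧ j = l then 1 else 0) + (if i = l ∧ j = k then 1 else 0)) / 2 := by
  simp_rw [← dotMap_symmSingle, sum_dotCoeff_mul_dotMap]
  rfl

theorem sum_dotCoeff_inr_mul_loop (e : Fin L × Fin n) (k l : Fin L) :
    ∑ a, F.dotCoeff (Sum.inr e) a * (F.α a k * F.α a l) = 0 := by
  simp_rw [← dotMap_symmSingle, sum_dotCoeff_mul_dotMap]
  rfl

theorem sum_dotCoeff_mul_ext (e : DotIdx L n) (k : Fin L) (s : Fin n) :
    ∑ a, F.dotCoeff e a * (F.α a k * F.β a s) = if e = Sum.inr (k, s) then 2⁻¹ else 0 := by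
  simp_rw [← dotMap_single_inr, sum_dotCoeff_mul_dotMap, Pi.single_apply]

end DualBasis

/-- `quadMatrix` at elements `x` of a ring: the matrix of `∑ a, x_a * q_a ^ 2` in the loop
momenta. -/
def loopMatrix {R : Type*} [CommRing R] (x : Fin p → R) : Matrix (Fin L) (Fin L) R :=
  Matrix.of fun i j => ∑ a, x a * F.α a i * F.α a j

/-- `linMatrix` at elements `x` of a ring: the mixed coefficients of `∑ a, x_a * q_a ^ 2`. -/
def mixedMatrix {R : Type*} [CommRing R] (x : Fin p → R) : Matrix (Fin L) (Fin n) R :=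
  Matrix.of fun i r => ∑ a, x a * F.α a i * F.β a r

theorem loopMatrix_isSymm {R : Type*} [CommRing R] (x : Fin p → R) : (F.loopMatrix x).IsSymm := by
  ext i j
  simp [loopMatrix, mul_right_comm]

theorem map_loopMatrix {R R' : Type*} [CommRing R] [CommRing R'] (f : R →+* R') (x : Fin p → R) :
    (F.loopMatrix x).map f = F.loopMatrix (f ∘ x) := by
  ext i j
  simp [loopMatrix]

theorem map_mixedMatrix {R R' : Type*} [CommRing R] [CommRing R'] (f : R →+* R')
    (x : Fin p → R) : (F.mixedMatrix x).map f = F.mixedMatrix (f ∘ x) := by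
  ext i r
  simp [mixedMatrix]

end CompleteFamily

/-- A real matrix with entries regarded as constants of a complex algebra. -/
def constMatrix {m n : Type*} (R : Type*) [CommRing R] [Algebra ℂ R] (S : Matrix m n ℝ) :
    Matrix m n R :=
  S.map ((algebraMap ℂ R).comp Complex.ofRealHom)

section ConstMatrix

variable {R : Type*} [CommRing R] [Algebra ℂ R]

theorem derivation_map_constMatrix {m n : Type*} (d : Derivation ℂ R R) (S : Matrix m n ℝ) :
    (constMatrix R S).map d = 0 := by
  ext i j
  simp [constMatrix]

theorem constMatrix_isSymm {n : Type*} {S : Matrix n n ℝ} (hS : S.IsSymm) :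
    (constMatrix R S).IsSymm :=
  hS.map _

theorem constMatrix_mul_inv {n : Type*} [Fintype n] [DecidableEq n] {S : Matrix n n ℝ}
    (hS : S.det ≠ 0) : constMatrix R S * constMatrix R S⁻¹ = 1 := by
  rw [constMatrix, constMatrix, ← Matrix.map_mul,
    Matrix.mul_nonsing_inv _ (isUnit_iff_ne_zero.mpr hS), Matrix.map_one _ (map_zero _) (map_one _)]

theorem sum_inv_smul_constMatrix {n : ℕ} {S : Matrix (Fin n) (Fin n) ℝ} (hS : S.IsSymm)
    (hG : S.det ≠ 0) :
    ∑ r, ∑ s, ((S⁻¹ r s : ℝ) : ℂ) • constMatrix R S r s = (n : ℂ) • (1 : R) := by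
  have htrace : ∑ r, ∑ s, S⁻¹ r s * S r s = n := by
    have h : (S⁻¹ * S).trace = n := by
      rw [Matrix.nonsing_inv_mul _ (isUnit_iff_ne_zero.mpr hG), Matrix.trace_one, Fintype.card_fin]
    simpa [Matrix.trace, Matrix.mul_apply, hS.apply] using h
  simp only [constMatrix, Matrix.map_apply, RingHom.comp_apply, Complex.ofRealHom_eq_coe,
    Algebra.algebraMap_eq_smul_one, smul_smul, ← Finset.sum_smul, ← Complex.ofReal_mul,
    ← Complex.ofReal_sum, htrace, Complex.ofReal_natCast]

end ConstMatrix

/-- A commutative differential algebra modelled on the Schwinger kernel: `x` are the Schwinger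
parameters with partial derivatives `d`, `G` is the inverse of the matrix of the quadratic form, and
`E` obeys the differential equations of `𝒰 ^ w * exp (-i ℱ / 𝒰)`. -/
structure KernelModel {L n p : ℕ} (F : CompleteFamily L n p) (S : Matrix (Fin n) (Fin n) ℝ)
    (M : Fin p → ℂ) (w : ℂ) (R : Type*) [CommRing R] [Algebra ℂ R] where
  d : Fin p → Derivation ℂ R R
  d_comm : ∀ a b f, d a (d b f) = d b (d a f)
  x : Fin p → R
  d_x : ∀ a b, d a (x b) = if a = b then 1 else 0
  G : Matrix (Fin L) (Fin L) R
  A_mul_G : F.loopMatrix x * G = 1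
  E : R
  d_E : ∀ a, d a E = E * (w • (G.det * d a (F.loopMatrix x).det) - Complex.I • d a
    ((∑ b, (M b - F.extSq S b) • x b) +
      (G * (F.mixedMatrix x * constMatrix R S * (F.mixedMatrix x).transpose)).trace))

namespace KernelModel

variable {L n p : ℕ} {F : CompleteFamily L n p} {S : Matrix (Fin n) (Fin n) ℝ}
  {M : Fin p → ℂ} {w : ℂ} {R : Type*} [CommRing R] [Algebra ℂ R] (K : KernelModel F S M w R)

/-- The matrix of the quadratic form in the loop momenta. -/
abbrev A : Matrix (Fin L) (Fin L) R := F.loopMatrix K.x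

/-- The coefficients of the linear form in the loop momenta. -/
abbrev B : Matrix (Fin L) (Fin n) R := F.mixedMatrix K.x

/-- The operator `P(i ∂ / ∂ x)`. -/
abbrev op : MvPolynomial (Fin p) ℂ →ₐ[ℂ] Module.End ℂ R := diffOp K.d K.d_comm

/-- The trace part of the exponent of the kernel. -/
def tau : R := (K.G * (K.B * constMatrix R S * K.B.transpose)).trace

/-- The derivation dual to the dot product `e`. -/
def delta (e : DotIdx L n) : Derivation ℂ R R := ∑ a, (F.dotCoeff e a : ℂ) • K.d a

theorem delta_apply (e : DotIdx L n) (f : R) :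
    K.delta e f = ∑ a, (F.dotCoeff e a : ℂ) • K.d a f := by
  rw [delta, ← Derivation.coeFnAddMonoidHom_apply, map_sum, Finset.sum_apply]; rfl

theorem delta_x (e : DotIdx L n) (a : Fin p) :
    K.delta e (K.x a) = algebraMap ℂ R (F.dotCoeff e a) := by
  simp [delta_apply, K.d_x, Algebra.algebraMap_eq_smul_one]

theorem op_dotPoly (e : DotIdx L n) (f : R) :
    K.op (F.dotPoly S M e) f =
      (∑ a, (F.dotCoeff e a : ℂ) * (M a - F.extSq S a)) • f - Complex.I • K.delta e f := by
  simp only [CompleteFamily.dotPoly, map_sum, LinearMap.sum_apply, diffOp_mul, diffOp_C, map_sub,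
    LinearMap.sub_apply, diffOp_X, K.delta_apply, Finset.sum_smul, Finset.smul_sum,
    ← Finset.sum_sub_distrib, CompleteFamily.dotCoeff]
  refine Finset.sum_congr rfl fun a _ => ?_
  module

theorem G_isSymm : K.G.IsSymm := by
  have h : K.G.transpose * K.A = 1 := by
    have hA : K.A.transpose = K.A := F.loopMatrix_isSymm K.x
    rw [← hA, ← Matrix.transpose_mul, K.A_mul_G, Matrix.transpose_one]
  exact left_inv_eq_right_inv h K.A_mul_G

theorem det_A_mul_det_G : K.A.det * K.G.det = 1 := by
  rw [← Matrix.det_mul, K.A_mul_G, Matrix.det_one]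

section DualDerivatives

theorem delta_A (e : DotIdx L n) (k l : Fin L) : K.delta e (K.A k l) =
    algebraMap ℂ R (∑ a, F.dotCoeff e a * (F.α a k * F.α a l) : ℝ) := by
  simp [CompleteFamily.loopMatrix, delta_x, mul_left_comm, mul_comm, mul_assoc]

theorem delta_B (e : DotIdx L n) (k : Fin L) (s : Fin n) : K.delta e (K.B k s) =
    algebraMap ℂ R (∑ a, F.dotCoeff e a * (F.α a k * F.β a s) : ℝ) := by
  simp [CompleteFamily.mixedMatrix, delta_x, mul_left_comm, mul_comm, mul_assoc]

theorem map_A_inl (i j : Fin L) : K.A.map (K.delta (Sum.inl s(i, j))) =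
    (2⁻¹ : ℂ) • (Matrix.single i j 1 + Matrix.single j i 1) := by
  ext k l
  rw [Matrix.map_apply, delta_A, F.sum_dotCoeff_inl_mul_loop]
  simp only [Matrix.smul_apply, Matrix.add_apply, Matrix.single_apply,
    Algebra.algebraMap_eq_smul_one, and_comm (a := j = k)]
  split_ifs <;> (simp [← add_smul]; try norm_num)

theorem map_A_inr (e : Fin L × Fin n) : K.A.map (K.delta (Sum.inr e)) = 0 := by
  ext k l
  simp [delta_A, F.sum_dotCoeff_inr_mul_loop]

theorem map_B_inl (s : Sym2 (Fin L)) : K.B.map (K.delta (Sum.inl s)) = 0 := by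
  ext k l
  simp [delta_B, F.sum_dotCoeff_mul_ext]

theorem map_B_inr (i : Fin L) (r : Fin n) : K.B.map (K.delta (Sum.inr (i, r))) =
    (2⁻¹ : ℂ) • Matrix.single i r 1 := by
  ext k l
  simp only [Matrix.map_apply, delta_B, F.sum_dotCoeff_mul_ext, Matrix.smul_apply,
    Matrix.single_apply, Algebra.algebraMap_eq_smul_one, Sum.inr.injEq, Prod.mk.injEq]
  split_ifs <;> simp

end DualDerivatives

theorem delta_G (i j k l : Fin L) : 2 * K.delta (Sum.inl s(i, j)) (K.G k l) =
    -(K.G k i * K.G j l + K.G k j * K.G i l) := by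
  have h := congrFun₂ (derivation_map_inverse (K.delta (Sum.inl s(i, j))) K.A_mul_G) k l
  rw [Matrix.map_apply] at h
  rw [h, K.map_A_inl]
  simp only [Matrix.mul_smul, Matrix.smul_mul, Matrix.mul_add, Matrix.add_mul, Matrix.neg_apply,
    Matrix.smul_apply, Matrix.add_apply, mul_single_mul_apply]
  rw [two_mul]
  module

theorem map_G_inr (e : Fin L × Fin n) : K.G.map (K.delta (Sum.inr e)) = 0 := by
  rw [derivation_map_inverse _ K.A_mul_G, K.map_A_inr, Matrix.mul_zero, Matrix.zero_mul, neg_zero]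

theorem delta_inr_det_submatrix (e : Fin L × Fin n) {m : ℕ} (i j : Fin m → Fin L) :
    K.delta (Sum.inr e) (K.G.submatrix i j).det = 0 := by
  have hzero : (K.G.submatrix i j).map (K.delta (Sum.inr e)) = 0 := by
    rw [← Matrix.submatrix_map, map_G_inr]
    rfl
  rw [derivation_det, hzero, Matrix.zero_mul, Matrix.trace_zero]

theorem det_G_mul_delta_inl_det_A (i j : Fin L) :
    K.G.det * K.delta (Sum.inl s(i, j)) K.A.det = K.G i j := by
  rw [det_mul_derivation_det _ K.A_mul_G, map_A_inl, trace_symmSingle_mul _ K.G_isSymm]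

theorem det_G_mul_delta_inr_det_A (e : Fin L × Fin n) :
    K.G.det * K.delta (Sum.inr e) K.A.det = 0 := by
  rw [det_mul_derivation_det _ K.A_mul_G, map_A_inr, Matrix.zero_mul, Matrix.trace_zero]

/-- The matrix `A⁻¹ B S`. -/
def V : Matrix (Fin L) (Fin n) R := K.G * K.B * constMatrix R S

/-- The matrix `A⁻¹ B S Bᵀ A⁻¹`. -/
def W : Matrix (Fin L) (Fin L) R := K.G * (K.B * constMatrix R S * K.Bᵀ) * K.G

theorem delta_inr_V (i j : Fin L) (r s : Fin n) : K.delta (Sum.inr (i, r)) (K.V j s) =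
    (2⁻¹ : ℂ) • (K.G i j * constMatrix R S r s) := by
  have h : K.V.map (K.delta (Sum.inr (i, r))) =
      K.G * ((2⁻¹ : ℂ) • Matrix.single i r (1 : R)) * constMatrix R S := by
    rw [V, derivation_map_mul, derivation_map_mul, derivation_map_constMatrix, K.map_G_inr,
      K.map_B_inr, Matrix.zero_mul, zero_add, Matrix.mul_zero, add_zero]
  rw [← Matrix.map_apply (f := K.delta _), h, Matrix.mul_smul, Matrix.smul_mul, Matrix.smul_apply,
    mul_single_mul_apply, K.G_isSymm.apply]

theorem delta_E (e : DotIdx L n) : K.delta e K.E = K.E * (w • (K.G.det * K.delta e K.A.det)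
    - Complex.I • (algebraMap ℂ R (∑ a, (F.dotCoeff e a : ℂ) * (M a - F.extSq S a)) +
      K.delta e K.tau)) := by
  have hmass : K.delta e (∑ a, (M a - F.extSq S a) • K.x a) =
      algebraMap ℂ R (∑ a, (F.dotCoeff e a : ℂ) * (M a - F.extSq S a)) := by
    simp only [map_sum, Derivation.map_smul, delta_x, map_mul]
    exact Finset.sum_congr rfl fun a _ => by rw [Algebra.smul_def, mul_comm]
  have hd (a : Fin p) : K.d a K.E = K.E * (w • (K.G.det * K.d a K.A.det) - Complex.I • K.d a
    ((∑ b, (M b - F.extSq S b) • K.x b) + K.tau)) := K.d_E a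
  rw [← hmass, ← map_add]
  simp only [delta_apply, hd, Finset.mul_sum, Finset.smul_sum, ← Finset.sum_sub_distrib]
  refine Finset.sum_congr rfl fun a _ => ?_
  simp only [Algebra.smul_def]
  ring

/-- The constant part of `dotPoly` cancels against the mass term in the exponent of the kernel. -/
theorem op_dotPoly_E_mul (e : DotIdx L n) (g : R) :
    K.op (F.dotPoly S M e) (K.E * g) = -Complex.I • (K.E * (K.delta e g +
      w • (K.G.det * K.delta e K.A.det * g) - Complex.I • (K.delta e K.tau * g))) := by
  rw [op_dotPoly, Derivation.leibniz, K.delta_E]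
  simp only [Algebra.smul_def, map_neg]
  linear_combination (K.E * g * algebraMap ℂ R (∑ a, (F.dotCoeff e a : ℂ) *
    (M a - F.extSq S a))) * algebraMap_I_mul_self (R := R)

section

variable (hS : S.IsSymm)
include hS

theorem W_isSymm : K.W.IsSymm := by
  rw [Matrix.IsSymm, W]
  simp only [Matrix.transpose_mul, K.G_isSymm.eq, (constMatrix_isSymm hS).eq,
    Matrix.transpose_transpose, Matrix.mul_assoc]

theorem delta_inl_tau (i j : Fin L) : K.delta (Sum.inl s(i, j)) K.tau = -K.W i j := by
  set δ := K.delta (Sum.inl s(i, j))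
  have hB : K.B.map δ = 0 := K.map_B_inl _
  calc δ K.tau = -(K.G * (K.A.map δ * (K.G * (K.B * constMatrix R S * K.Bᵀ)))).trace := by
        rw [tau, derivation_trace, derivation_map_mul, derivation_map_mul, derivation_map_mul,
          Matrix.transpose_map, hB, derivation_map_constMatrix,
          derivation_map_inverse δ K.A_mul_G]
        simp only [Matrix.zero_mul, Matrix.mul_zero, Matrix.transpose_zero, add_zero,
          Matrix.neg_mul, Matrix.trace_neg, Matrix.mul_assoc]
    _ = -(K.A.map δ * K.W).trace := by rw [Matrix.trace_mul_comm, Matrix.mul_assoc, W]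
    _ = -K.W i j := by rw [K.map_A_inl, trace_symmSingle_mul _ (K.W_isSymm hS)]

theorem delta_inr_tau (i : Fin L) (r : Fin n) : K.delta (Sum.inr (i, r)) K.tau = K.V i r := by
  set δ := K.delta (Sum.inr (i, r))
  have hV : (K.G * (K.B * constMatrix R S * (K.B.map δ)ᵀ)).trace = (2⁻¹ : ℂ) • K.V i r := by
    rw [K.map_B_inr, Matrix.transpose_smul, Matrix.transpose_single, Matrix.mul_smul,
      Matrix.mul_smul, Matrix.trace_smul, ← Matrix.mul_assoc, ← Matrix.mul_assoc, ← V,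
      Matrix.trace_mul_single, MulOpposite.op_one, one_smul]
  calc δ K.tau = (K.G * (K.B.map δ * constMatrix R S * K.Bᵀ)).trace +
        (K.G * (K.B * constMatrix R S * (K.B.map δ)ᵀ)).trace := by
        rw [tau, derivation_trace, derivation_map_mul, derivation_map_mul, derivation_map_mul,
          K.map_G_inr, derivation_map_constMatrix, Matrix.transpose_map]
        simp only [Matrix.zero_mul, Matrix.mul_zero, add_zero, zero_add, Matrix.mul_add,
          Matrix.trace_add]
    _ = K.V i r := by
        rw [trace_mul_mul_transpose_comm K.G_isSymm (constMatrix_isSymm hS), hV, ← add_smul]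
        norm_num

theorem op_dotPoly_inl (i j : Fin L) (g : R) :
    K.op (F.dotPoly S M (Sum.inl s(i, j))) (K.E * g) =
      -Complex.I • (K.E * (K.delta (Sum.inl s(i, j)) g + w • (K.G i j * g)
        + Complex.I • (K.W i j * g))) := by
  rw [K.op_dotPoly_E_mul, K.det_G_mul_delta_inl_det_A, K.delta_inl_tau hS, neg_mul, smul_neg,
    sub_neg_eq_add]

theorem op_dotPoly_inr (i : Fin L) (r : Fin n) (g : R) :
    K.op (F.dotPoly S M (Sum.inr (i, r))) (K.E * g) =
      -Complex.I • (K.E * (K.delta (Sum.inr (i, r)) g - Complex.I • (K.V i r * g))) := by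
  rw [K.op_dotPoly_E_mul, K.det_G_mul_delta_inr_det_A, K.delta_inr_tau hS, zero_mul, smul_zero,
    add_zero]

theorem op_dotPoly_inr_mul_dotPoly_inr (i j : Fin L) (r s : Fin n) (c : ℂ) (g : R)
    (hg : ∀ e, K.delta (Sum.inr e) g = 0) :
    K.op (F.dotPoly S M (Sum.inr (i, r)) * MvPolynomial.C c * F.dotPoly S M (Sum.inr (j, s)))
        (K.E * g) =
      -Complex.I • (K.E * (Complex.I • (c • (K.V i r * K.V j s) * g) -
        (2⁻¹ : ℂ) • (c • constMatrix R S r s) * (K.G i j * g))) := by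
  have hright : K.op (F.dotPoly S M (Sum.inr (j, s))) (K.E * g) = K.E * -(K.V j s * g) := by
    rw [K.op_dotPoly_inr hS, hg]
    simp only [Algebra.smul_def, map_neg]
    linear_combination (K.E * K.V j s * g) * algebraMap_I_mul_self (R := R)
  rw [diffOp_mul, diffOp_mul, hright, diffOp_C, map_smul, K.op_dotPoly_inr hS, map_neg,
    Derivation.leibniz, hg, K.delta_inr_V]
  simp only [Algebra.smul_def, map_neg, Algebra.algebraMap_self, RingHom.id_apply]
  ring

end

end KernelModel

namespace CompleteFamily

variable {L n p : ℕ} (F : CompleteFamily L n p) (S : Matrix (Fin n) (Fin n) ℝ) (M : Fin p → ℂ)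

/-- The Schur complement of the external Gram matrix in the full Gram matrix, as a matrix of
polynomials in the inverse propagators. -/
def schurComplement : Matrix (Fin L) (Fin L) (MvPolynomial (Fin p) ℂ) :=
  (Matrix.of fun i j : Fin L => F.dotPoly S M (Sum.inl s(i, j))) -
    (Matrix.of fun (i : Fin L) (r : Fin n) => F.dotPoly S M (Sum.inr (i, r))) *
      constMatrix (MvPolynomial (Fin p) ℂ) S⁻¹ *
    Matrix.of fun (r : Fin n) (i : Fin L) => F.dotPoly S M (Sum.inr (i, r))

theorem schurComplement_apply (i j : Fin L) :
    F.schurComplement S M i j = F.dotPoly S M (Sum.inl s(i, j)) - ∑ r, ∑ s,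
      F.dotPoly S M (Sum.inr (i, r)) * MvPolynomial.C ((S⁻¹ r s : ℝ) : ℂ) *
      F.dotPoly S M (Sum.inr (j, s)) := by
  rw [Finset.sum_comm]
  simp [schurComplement, constMatrix, Matrix.mul_apply, Finset.sum_mul,
    MvPolynomial.algebraMap_eq]

variable {S}

theorem baikovPoly_eq_C_mul_det_schurComplement (hG : S.det ≠ 0) :
    F.baikovPoly S M = MvPolynomial.C (S.det : ℂ) * (F.schurComplement S M).det := by
  have hinv : constMatrix (MvPolynomial (Fin p) ℂ) S * constMatrix _ S⁻¹ = 1 :=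
    constMatrix_mul_inv hG
  let _ : Invertible (constMatrix (MvPolynomial (Fin p) ℂ) S) :=
    ⟨constMatrix _ S⁻¹, mul_eq_one_comm.mp hinv, hinv⟩
  have hdet : (constMatrix (MvPolynomial (Fin p) ℂ) S).det = MvPolynomial.C (S.det : ℂ) :=
    (RingHom.map_det _ S).symm
  rw [← hdet]
  exact Matrix.det_fromBlocks₂₂ _ _ _ (constMatrix (MvPolynomial (Fin p) ℂ) S)

end CompleteFamily

theorem prod_range_half_eq_ascPochhammer (D : ℂ) (L n : ℕ) :
    ∏ t ∈ Finset.range L, (-D / 2 + n / 2 + t / 2 : ℂ) =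
      (-2⁻¹) ^ L * (ascPochhammer ℂ L).eval (D - ((L + n : ℕ) : ℂ) + 1) := by
  induction L with
  | zero => simp
  | succ L ih =>
    have hshift : D - ((L + 1 + n : ℕ) : ℂ) + 1 + 1 = D - ((L + n : ℕ) : ℂ) + 1 := by
      push_cast; ring
    rw [Finset.prod_range_succ, ih, ascPochhammer_succ_left, Polynomial.eval_mul, Polynomial.eval_X,
      Polynomial.eval_comp, Polynomial.eval_add, Polynomial.eval_X, Polynomial.eval_one, hshift]
    push_cast
    ring

namespace KernelModel

variable {L n p : ℕ} {F : CompleteFamily L n p} {S : Matrix (Fin n) (Fin n) ℝ}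
  {M : Fin p → ℂ} {w : ℂ} {R : Type*} [CommRing R] [Algebra ℂ R] (K : KernelModel F S M w R)
  (hS : S.IsSymm) (hG : S.det ≠ 0)

include hS hG

theorem sum_inv_smul_V_mul_V (i j : Fin L) :
    ∑ r, ∑ s, ((S⁻¹ r s : ℝ) : ℂ) • (K.V i r * K.V j s) = K.W i j := by
  have hW : K.W = K.V * constMatrix R S⁻¹ * K.Vᵀ := by
    simp only [W, V, Matrix.transpose_mul, K.G_isSymm.eq, (constMatrix_isSymm hS).eq]
    rw [Matrix.mul_assoc (K.G * K.B) (constMatrix R S), constMatrix_mul_inv hG, Matrix.mul_one]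
    simp only [Matrix.mul_assoc]
  rw [hW, Finset.sum_comm, Matrix.mul_apply]
  simp only [Matrix.mul_apply, Finset.sum_mul, Algebra.smul_def, Matrix.transpose_apply]
  exact Finset.sum_congr rfl fun s _ => Finset.sum_congr rfl fun r _ =>
    (mul_left_comm _ _ _).trans (mul_assoc _ _ _).symm

/-- The terms with `W` of the two parts of the Schur complement cancel, and the second part
contributes the shift `n / 2` of the exponent. -/
theorem op_schurComplement (i j : Fin L) (g : R) (hg : ∀ e, K.delta (Sum.inr e) g = 0) :
    K.op (F.schurComplement S M i j) (K.E * g) = -Complex.I • (K.E *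
      (K.delta (Sum.inl s(i, j)) g + (w + n / 2) • (K.G i j * g))) := by
  rw [F.schurComplement_apply, map_sub, LinearMap.sub_apply, K.op_dotPoly_inl hS]
  simp only [map_sum, LinearMap.sum_apply, K.op_dotPoly_inr_mul_dotPoly_inr hS _ _ _ _ _ g hg,
    ← Finset.smul_sum, ← Finset.mul_sum, Finset.sum_sub_distrib, ← Finset.sum_mul,
    K.sum_inv_smul_V_mul_V hS hG, sum_inv_smul_constMatrix hS hG]
  simp only [Algebra.smul_def, map_neg, map_add, map_natCast, div_eq_mul_inv, map_mul]
  ring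

theorem op_cofactor_schurComplement {m : ℕ} (i j : Fin (m + 1) → Fin L) (b : Fin (m + 1)) {c : ℂ}
    (hminor : K.op ((F.schurComplement S M).submatrix (i ∘ Fin.succ) (j ∘ b.succAbove)).det K.E =
      c • (K.E * (K.G.submatrix (i ∘ Fin.succ) (j ∘ b.succAbove)).det)) :
    K.op ((-1) ^ (b : ℕ) * F.schurComplement S M (i 0) (j b) *
        ((F.schurComplement S M).submatrix (i ∘ Fin.succ) (j ∘ b.succAbove)).det) K.E =
      (-Complex.I * c) • (K.E *
        ((-1) ^ (b : ℕ) * K.delta (Sum.inl s(i 0, j b))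
            (K.G.submatrix (i ∘ Fin.succ) (j ∘ b.succAbove)).det +
          (w + n / 2) • ((-1) ^ (b : ℕ) * K.G (i 0) (j b) *
            (K.G.submatrix (i ∘ Fin.succ) (j ∘ b.succAbove)).det))) := by
  have hsign : ((-1) ^ (b : ℕ) : MvPolynomial (Fin p) ℂ) = MvPolynomial.C ((-1) ^ (b : ℕ)) := by
    simp
  rw [hsign, diffOp_mul, diffOp_mul, diffOp_C, hminor, map_smul,
    K.op_schurComplement hS hG _ _ _ fun e => K.delta_inr_det_submatrix e _ _]
  simp only [Algebra.smul_def, map_mul, map_neg, map_pow, map_one]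
  ring

theorem op_det_submatrix_schurComplement {m : ℕ} (i j : Fin m → Fin L) :
    K.op ((F.schurComplement S M).submatrix i j).det K.E =
      ((-Complex.I) ^ m * ∏ t ∈ Finset.range m, (w + n / 2 + t / 2)) •
        (K.E * (K.G.submatrix i j).det) := by
  induction m with
  | zero => simp
  | succ m ih =>
    have hcayley : ∑ b : Fin (m + 1), (-1) ^ (b : ℕ) * K.delta (Sum.inl s(i 0, j b))
        (K.G.submatrix (i ∘ Fin.succ) (j ∘ b.succAbove)).det =
          ((m : ℂ) / 2) • (K.G.submatrix i j).det := by
      rw [div_eq_inv_mul, mul_smul, eq_inv_smul_iff₀ two_ne_zero, Algebra.smul_def,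
        Algebra.smul_def, map_ofNat, map_natCast]
      exact two_mul_sum_deriv_minor K.G (fun i j => K.delta (Sum.inl s(i, j))) K.delta_G
        K.G_isSymm i j
    have hexpand : (K.G.submatrix i j).det = ∑ b : Fin (m + 1), (-1) ^ (b : ℕ) *
        K.G (i 0) (j b) * (K.G.submatrix (i ∘ Fin.succ) (j ∘ b.succAbove)).det :=
      Matrix.det_succ_row_zero _
    rw [Matrix.det_succ_row_zero, map_sum, LinearMap.sum_apply]
    simp only [Matrix.submatrix_apply, Matrix.submatrix_submatrix,
      K.op_cofactor_schurComplement hS hG i j _ (ih _ _)]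
    rw [← Finset.smul_sum, ← Finset.mul_sum, Finset.sum_add_distrib, ← Finset.smul_sum, ← hexpand,
      hcayley, Finset.prod_range_succ, ← add_smul, pow_succ]
    simp only [Algebra.smul_def, map_mul, map_add]
    ring

omit K in
theorem op_baikovPoly {D : ℂ} (K : KernelModel F S M (-D / 2) R) :
    K.op (F.baikovPoly S M) K.E = (S.det * (Complex.I / 2) ^ L *
      (ascPochhammer ℂ L).eval (D - ((L + n : ℕ) : ℂ) + 1) : ℂ) • (K.E * K.G.det) := by
  have h := K.op_det_submatrix_schurComplement hS hG id id
  rw [Matrix.submatrix_id_id, Matrix.submatrix_id_id, prod_range_half_eq_ascPochhammer,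
    ← mul_assoc, ← mul_pow] at h
  rw [F.baikovPoly_eq_C_mul_det_schurComplement M hG, diffOp_mul, h, diffOp_C, smul_smul,
    ← mul_assoc]
  congr 4
  ring

end KernelModel

open scoped ContDiff

section SmoothFunctions

variable {E : Type*} [NormedAddCommGroup E] [NormedSpace ℝ E] {U : TopologicalSpace.Opens E}

/-- The extension by zero of a complex function on an open set. -/
def extendZero (f : U → ℂ) : E → ℂ := Function.extend Subtype.val f 0

omit [NormedSpace ℝ E] in
theorem extendZero_coe (f : U → ℂ) (s : U) : extendZero f s = f s :=
  Subtype.val_injective.extend_apply f 0 s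

omit [NormedSpace ℝ E] in
theorem eqOn_extendZero {f : U → ℂ} {g : E → ℂ} (h : ∀ s : U, f s = g s) :
    Set.EqOn (extendZero f) g U :=
  fun s hs => (extendZero_coe f ⟨s, hs⟩).trans (h ⟨s, hs⟩)

theorem fderiv_extendZero {f : U → ℂ} {g : E → ℂ} (h : ∀ s : U, f s = g s) (s : U) :
    fderiv ℝ (extendZero f) s = fderiv ℝ g s :=
  ((eqOn_extendZero h).eventuallyEq_of_mem (U.isOpen.mem_nhds s.2)).fderiv_eq

theorem contDiffOn_extendZero {f : U → ℂ} {g : E → ℂ} (h : ∀ s : U, f s = g s)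
    (hg : ContDiffOn ℝ ∞ g U) : ContDiffOn ℝ ∞ (extendZero f) U :=
  hg.congr (eqOn_extendZero h)

/-- The algebra of smooth complex functions on an open set. Smoothness is a condition on the
extension by zero, since `U` itself carries no normed structure. -/
def smoothAlgebra (U : TopologicalSpace.Opens E) : Subalgebra ℂ (U → ℂ) where
  carrier := {f | ContDiffOn ℝ ∞ (extendZero f) U}
  mul_mem' {f g} hf hg := contDiffOn_extendZero (g := extendZero f * extendZero g)
    (fun s => by simp [extendZero_coe]) (ContDiffOn.mul hf hg)
  add_mem' {f g} hf hg := contDiffOn_extendZero (g := extendZero f + extendZero g)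
    (fun s => by simp [extendZero_coe]) (ContDiffOn.add hf hg)
  algebraMap_mem' c := contDiffOn_extendZero (g := fun _ => c) (fun _ => rfl) contDiffOn_const

namespace smoothAlgebra

/-- The evaluation at a point. -/
def eval (s : U) : smoothAlgebra U →ₐ[ℂ] ℂ :=
  (Pi.evalAlgHom ℂ (fun _ : U => ℂ) s).comp (smoothAlgebra U).val

theorem eval_ext {f g : smoothAlgebra U} (h : ∀ s, eval s f = eval s g) : f = g :=
  Subtype.ext (funext h)

/-- The extension by zero of smooth functions. -/
def extend : smoothAlgebra U →ₗ[ℂ] E → ℂ :=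
  Function.ExtendByZero.linearMap ℂ Subtype.val ∘ₗ (smoothAlgebra U).val.toLinearMap

theorem extend_coe (f : smoothAlgebra U) (s : U) : extend f s = eval s f :=
  extendZero_coe f.1 s

theorem extend_of_notMem (f : smoothAlgebra U) {s : E} (hs : s ∉ U) : extend f s = 0 :=
  Function.extend_apply' _ _ _ fun ⟨t, ht⟩ => hs (ht ▸ t.2)

theorem contDiffOn_extend (f : smoothAlgebra U) : ContDiffOn ℝ ∞ (extend f) U := f.2

theorem contDiffAt_extend (f : smoothAlgebra U) (s : U) : ContDiffAt ℝ ∞ (extend f) s :=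
  (contDiffOn_extend f).contDiffAt (U.isOpen.mem_nhds s.2)

theorem differentiableAt_extend (f : smoothAlgebra U) (s : U) :
    DifferentiableAt ℝ (extend f) s :=
  (contDiffAt_extend f s).differentiableAt (by simp)

theorem fderiv_extend (f : smoothAlgebra U) {g : E → ℂ} (h : ∀ s : U, eval s f = g s) (s : U) :
    fderiv ℝ (extend f) s = fderiv ℝ g s :=
  fderiv_extendZero h s

/-- The restriction to `U` of a function that is smooth on `U`. -/
def ofContDiffOn (g : E → ℂ) (hg : ContDiffOn ℝ ∞ g U) : smoothAlgebra U :=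
  ⟨fun s => g s, contDiffOn_extendZero (fun _ => rfl) hg⟩

@[simp]
theorem eval_ofContDiffOn (g : E → ℂ) (hg : ContDiffOn ℝ ∞ g U) (s : U) :
    eval s (ofContDiffOn g hg) = g s := rfl

theorem contDiffOn_fderiv_extend (f : smoothAlgebra U) :
    ContDiffOn ℝ ∞ (fderiv ℝ (extend f)) U :=
  (contDiffOn_extend f).fderiv_of_isOpen U.isOpen (by simp)

/-- The derivative in the direction `v`. -/
def derivAlong (v : E) : Derivation ℂ (smoothAlgebra U) (smoothAlgebra U) :=
  Derivation.mk'
    { toFun f := ofContDiffOn (fun s => fderiv ℝ (extend f) s v)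
        ((contDiffOn_fderiv_extend f).clm_apply contDiffOn_const)
      map_add' f g := eval_ext fun s => by
        have h := fderiv_add (differentiableAt_extend f s) (differentiableAt_extend g s)
        simp [h]
      map_smul' c f := eval_ext fun s => by
        have h := fderiv_const_smul (differentiableAt_extend f s) c
        simp [h] }
    fun f g => eval_ext fun s => by
      have h : fderiv ℝ (extend (f * g)) s = fderiv ℝ (extend f * extend g) s :=
        fderiv_extend _ (fun s => by simp [extend_coe]) s
      rw [fderiv_mul (differentiableAt_extend f s) (differentiableAt_extend g s)] at h
      simp [h, extend_coe]

theorem eval_derivAlong (v : E) (f : smoothAlgebra U) (s : U) :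
    eval s (derivAlong v f) = fderiv ℝ (extend f) s v := rfl

theorem eval_derivAlong_of_eq (v : E) (f : smoothAlgebra U) {g : E → ℂ}
    (h : ∀ s : U, eval s f = g s) (s : U) : eval s (derivAlong v f) = fderiv ℝ g s v := by
  rw [eval_derivAlong, fderiv_extend f h]

theorem derivAlong_comm (v w : E) (f : smoothAlgebra U) :
    derivAlong v (derivAlong w f) = derivAlong w (derivAlong v f) := by
  have hsecond (v w : E) (s : U) : eval s (derivAlong v (derivAlong w f)) =
      fderiv ℝ (fderiv ℝ (extend f)) s v w := by
    have hd : DifferentiableAt ℝ (fderiv ℝ (extend f)) s :=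
      ((contDiffOn_fderiv_extend f).contDiffAt (U.isOpen.mem_nhds s.2)).differentiableAt (by simp)
    rw [eval_derivAlong_of_eq v _ (g := fun s => fderiv ℝ (extend f) s w) (eval_derivAlong w f),
      fderiv_clm_apply hd (by fun_prop)]
    simp
  have hsymm (s : U) : IsSymmSndFDerivAt ℝ (extend f) s :=
    (contDiffAt_extend f s).isSymmSndFDerivAt <| by
      rw [minSmoothness_of_isRCLikeNormedField]
      exact WithTop.coe_le_coe.mpr (le_top (a := (2 : ℕ∞)))
  exact eval_ext fun s => by rw [hsecond, hsecond, hsymm s]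

/-- The restriction of a linear form. -/
def ofDual (l : E →L[ℝ] ℝ) : smoothAlgebra U :=
  ofContDiffOn (fun s => (l s : ℂ)) (Complex.ofRealCLM.comp l).contDiff.contDiffOn

theorem derivAlong_ofDual (v : E) (l : E →L[ℝ] ℝ) :
    derivAlong v (ofDual l : smoothAlgebra U) = algebraMap ℂ _ (l v : ℂ) := by
  refine eval_ext fun s => ?_
  rw [eval_derivAlong_of_eq v (ofDual l) (g := Complex.ofRealCLM.comp l) fun _ => rfl,
    ContinuousLinearMap.fderiv, AlgHom.commutes]
  rfl

/-- The exponential of a smooth function. -/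
def exp (f : smoothAlgebra U) : smoothAlgebra U :=
  ofContDiffOn (fun s => Complex.exp (extend f s)) (contDiffOn_extend f).cexp

theorem eval_exp (f : smoothAlgebra U) (s : U) : eval s (exp f) = Complex.exp (eval s f) := by
  rw [exp, eval_ofContDiffOn, extend_coe]

theorem derivAlong_exp (v : E) (f : smoothAlgebra U) :
    derivAlong v (exp f) = exp f * derivAlong v f := by
  refine eval_ext fun s => ?_
  rw [eval_derivAlong_of_eq v (exp f) (g := fun s => Complex.exp (extend f s)) fun _ => rfl,
    (differentiableAt_extend f s).hasFDerivAt.cexp.fderiv, map_mul, eval_exp, ← extend_coe]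
  rfl

theorem contDiffOn_log_extend (f : smoothAlgebra U) (hf : ∀ s, eval s f ∈ Complex.slitPlane) :
    ContDiffOn ℝ ∞ (fun s => Complex.log (extend f s)) U := by
  intro s hs
  have hlog : ContDiffAt ℂ ∞ Complex.log (extend f s) :=
    Complex.contDiffAt_log (by rw [extend_coe f ⟨s, hs⟩]; exact hf ⟨s, hs⟩)
  exact (hlog.restrict_scalars ℝ).comp_contDiffWithinAt s (contDiffOn_extend f s hs)

/-- The principal logarithm of a smooth function with values in the slit plane. -/
def log (f : smoothAlgebra U) (hf : ∀ s, eval s f ∈ Complex.slitPlane) : smoothAlgebra U :=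
  ofContDiffOn _ (contDiffOn_log_extend f hf)

theorem eval_log (f : smoothAlgebra U) (hf : ∀ s, eval s f ∈ Complex.slitPlane) (s : U) :
    eval s (log f hf) = Complex.log (eval s f) := by
  rw [log, eval_ofContDiffOn, extend_coe]

theorem mul_derivAlong_log (v : E) (f : smoothAlgebra U)
    (hf : ∀ s, eval s f ∈ Complex.slitPlane) : f * derivAlong v (log f hf) = derivAlong v f := by
  have h : exp (log f hf) = f := eval_ext fun s => by
    rw [eval_exp, eval_log, Complex.exp_log (Complex.slitPlane_ne_zero (hf s))]
  conv_rhs => rw [← h, derivAlong_exp, h]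

theorem isUnit_of_forall_eval_ne_zero {f : smoothAlgebra U} (hf : ∀ s, eval s f ≠ 0) :
    IsUnit f := by
  have hinv : ContDiffOn ℝ ∞ (fun s => (extend f s)⁻¹) U :=
    (contDiffOn_extend f).inv fun s hs => by rw [extend_coe f ⟨s, hs⟩]; exact hf ⟨s, hs⟩
  refine IsUnit.of_mul_eq_one (ofContDiffOn _ hinv) (eval_ext fun s => ?_)
  rw [map_mul, map_one, eval_ofContDiffOn, extend_coe, mul_inv_cancel₀ (hf s)]

end smoothAlgebra

end SmoothFunctions

theorem isOpen_orthant (p : ℕ) : IsOpen (orthant p) := by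
  simp only [orthant, Set.ofPred_forall]
  exact isOpen_iInter_of_finite fun a => isOpen_lt continuous_const (continuous_apply a)

/-- The orthant of Schwinger parameters, bundled as an open set. -/
def openOrthant (p : ℕ) : TopologicalSpace.Opens (Fin p → ℝ) := ⟨orthant p, isOpen_orthant p⟩

/-- The algebra of smooth complex functions of positive Schwinger parameters. -/
abbrev SchwingerAlgebra (p : ℕ) : Subalgebra ℂ (openOrthant p → ℂ) := smoothAlgebra (openOrthant p)

namespace SchwingerAlgebra

variable {p : ℕ}

/-- The partial derivative with respect to a Schwinger parameter. -/
def pd (a : Fin p) : Derivation ℂ (SchwingerAlgebra p) (SchwingerAlgebra p) :=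
  smoothAlgebra.derivAlong (Pi.single a 1)

/-- A Schwinger parameter as a smooth function. -/
def coord (a : Fin p) : SchwingerAlgebra p :=
  smoothAlgebra.ofDual (ContinuousLinearMap.proj a)

theorem eval_coord (a : Fin p) (s : openOrthant p) : smoothAlgebra.eval s (coord a) = s.1 a := rfl

theorem pd_coord (a b : Fin p) : pd a (coord b) = if a = b then 1 else 0 := by
  rw [pd, coord, smoothAlgebra.derivAlong_ofDual, ContinuousLinearMap.proj_apply, Pi.single_apply]
  split_ifs <;> simp_all

theorem hasDerivAt_update (a : Fin p) (f : SchwingerAlgebra p) (s : openOrthant p) :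
    HasDerivAt (fun t => smoothAlgebra.extend f (Function.update s.1 a t))
      (smoothAlgebra.eval s (pd a f)) (s.1 a) := by
  have hf : HasFDerivAt (smoothAlgebra.extend f) (fderiv ℝ (smoothAlgebra.extend f) s)
      (Function.update s.1 a (s.1 a)) := by
    rw [Function.update_eq_self]
    exact (smoothAlgebra.differentiableAt_extend f s).hasFDerivAt
  exact hf.comp_hasDerivAt (s.1 a) (_root_.hasDerivAt_update s.1 a (s.1 a))

end SchwingerAlgebra

namespace CompleteFamily

variable {L n p : ℕ} (F : CompleteFamily L n p)

open smoothAlgebra SchwingerAlgebra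

theorem dotProduct_quadMatrix_mulVec (s : Fin p → ℝ) (v : Fin L → ℝ) :
    v ⬝ᵥ (F.quadMatrix s).mulVec v = ∑ a, s a * (∑ i, F.α a i * v i) ^ 2 := by
  simp only [dotProduct, Matrix.mulVec, quadMatrix, Matrix.of_apply, sq, Finset.sum_mul,
    Finset.mul_sum]
  rw [Finset.sum_comm_cycle]
  refine Finset.sum_congr rfl fun a _ => Finset.sum_congr rfl fun i _ =>
    Finset.sum_congr rfl fun j _ => ?_
  ring

theorem eq_zero_of_forall_sum_mul_eq_zero {v : Fin L → ℝ} (hv : ∀ a, ∑ i, F.α a i * v i = 0) :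
    v = 0 := by
  let y : DotIdx L n → ℝ :=
    Sum.elim (Sym2.lift ⟨fun i j => v i * v j, fun i j => mul_comm _ _⟩) 0
  have hy : dotMap F.α F.β y = 0 := by
    ext a
    have hsq : dotMap F.α F.β y a = (∑ i, F.α a i * v i) * ∑ j, F.α a j * v j := by
      simp only [Finset.sum_mul_sum]
      simp [dotMap, y, mul_mul_mul_comm]
    rw [hsq, hv, zero_mul, Pi.zero_apply]
  have hy0 : y = 0 := F.complete.1 (by rw [hy, map_zero])
  ext i
  simpa [y] using congrFun hy0 (Sum.inl s(i, i))

theorem posDef_quadMatrix {s : Fin p → ℝ} (hs : s ∈ orthant p) : (F.quadMatrix s).PosDef := by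
  have hsq (v : Fin L → ℝ) (a : Fin p) : 0 ≤ s a * (∑ i, F.α a i * v i) ^ 2 :=
    mul_nonneg (hs a).le (sq_nonneg _)
  refine Matrix.PosDef.of_dotProduct_mulVec_pos (F.loopMatrix_isSymm s) fun v hv => ?_
  rw [star_trivial, dotProduct_quadMatrix_mulVec]
  refine (Finset.sum_nonneg fun a _ => hsq v a).lt_of_ne' fun hsum => hv ?_
  refine F.eq_zero_of_forall_sum_mul_eq_zero fun a => ?_
  have ha := (Finset.sum_eq_zero_iff_of_nonneg fun a _ => hsq v a).mp hsum a (Finset.mem_univ a)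
  simpa [(hs a).ne'] using ha

theorem symanzikU_pos {s : Fin p → ℝ} (hs : s ∈ orthant p) : 0 < F.symanzikU s :=
  (F.posDef_quadMatrix hs).det_pos

theorem ofReal_symanzikU_ne_zero {s : Fin p → ℝ} (hs : s ∈ orthant p) :
    (F.symanzikU s : ℂ) ≠ 0 :=
  Complex.ofReal_ne_zero.mpr (F.symanzikU_pos hs).ne'

theorem map_eval_loopMatrix (s : openOrthant p) :
    (F.loopMatrix coord).map (eval s : SchwingerAlgebra p →+* ℂ) =
      (F.quadMatrix s.1).map Complex.ofRealHom := by
  rw [map_loopMatrix]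
  exact (F.map_loopMatrix Complex.ofRealHom s.1).symm

theorem map_eval_mixedMatrix (s : openOrthant p) :
    (F.mixedMatrix coord).map (eval s : SchwingerAlgebra p →+* ℂ) =
      (F.linMatrix s.1).map Complex.ofRealHom := by
  rw [map_mixedMatrix]
  exact (F.map_mixedMatrix Complex.ofRealHom s.1).symm

theorem eval_det_loopMatrix (s : openOrthant p) :
    eval s (F.loopMatrix coord).det = F.symanzikU s.1 := by
  have h := (eval s : SchwingerAlgebra p →+* ℂ).map_det (F.loopMatrix coord)
  rw [RingHom.mapMatrix_apply, map_eval_loopMatrix] at h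
  exact h.trans (Complex.ofRealHom.map_det _).symm

theorem eval_det_loopMatrix_mem_slitPlane (s : openOrthant p) :
    eval s (F.loopMatrix coord).det ∈ Complex.slitPlane := by
  rw [eval_det_loopMatrix]
  exact Complex.ofReal_mem_slitPlane.mpr (F.symanzikU_pos s.2)

theorem isUnit_det_loopMatrix :
    IsUnit (F.loopMatrix (coord : Fin p → SchwingerAlgebra p)).det :=
  isUnit_of_forall_eval_ne_zero fun s =>
    Complex.slitPlane_ne_zero (F.eval_det_loopMatrix_mem_slitPlane s)

theorem map_eval_inv_loopMatrix (s : openOrthant p) :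
    (F.loopMatrix coord)⁻¹.map (eval s : SchwingerAlgebra p →+* ℂ) =
      (F.quadMatrix s.1)⁻¹.map Complex.ofRealHom := by
  have hleft : (F.quadMatrix s.1)⁻¹.map Complex.ofRealHom *
      (F.quadMatrix s.1).map Complex.ofRealHom = 1 := by
    rw [← Matrix.map_mul, Matrix.nonsing_inv_mul _ (F.symanzikU_pos s.2).ne'.isUnit,
      Matrix.map_one _ (map_zero _) (map_one _)]
  have hright : (F.quadMatrix s.1).map Complex.ofRealHom *
      (F.loopMatrix coord)⁻¹.map (eval s : SchwingerAlgebra p →+* ℂ) = 1 := by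
    rw [← map_eval_loopMatrix, ← Matrix.map_mul, Matrix.mul_nonsing_inv _ F.isUnit_det_loopMatrix,
      Matrix.map_one _ (map_zero _) (map_one _)]
  exact (left_inv_eq_right_inv hleft hright).symm

variable (S : Matrix (Fin n) (Fin n) ℝ) (M : Fin p → ℂ)

/-- The exponent `ℱ / 𝒰` of the Schwinger kernel as a smooth function. -/
def smoothExponent : SchwingerAlgebra p :=
  (∑ b, (M b - F.extSq S b) • coord b) + ((F.loopMatrix coord)⁻¹ * (F.mixedMatrix coord *
    constMatrix (SchwingerAlgebra p) S * (F.mixedMatrix coord).transpose)).trace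

theorem symanzikF_div_symanzikU {s : Fin p → ℝ} (hs : s ∈ orthant p) :
    F.symanzikF S M s / F.symanzikU s = ∑ b, (M b - F.extSq S b) * s b +
      (((F.quadMatrix s)⁻¹ * (F.linMatrix s * S * (F.linMatrix s).transpose)).trace : ℝ) := by
  have hU := F.ofReal_symanzikU_ne_zero hs
  have hinv : (F.quadMatrix s)⁻¹ = (F.symanzikU s)⁻¹ • (F.quadMatrix s).adjugate := by
    rw [Matrix.inv_def, Ring.inverse_eq_inv', symanzikU]
  rw [hinv, smul_mul_assoc, Matrix.trace_smul, smul_eq_mul, symanzikF, symanzikFtilde]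
  simp only [sub_mul, Finset.sum_sub_distrib]
  push_cast
  field_simp
  simp only [mul_comm]
  ring

theorem eval_smoothExponent (s : openOrthant p) :
    eval s (F.smoothExponent S M) = F.symanzikF S M s.1 / F.symanzikU s.1 := by
  have htrace (f : SchwingerAlgebra p →+* ℂ) (X : Matrix (Fin L) (Fin L) (SchwingerAlgebra p)) :
      f X.trace = (X.map f).trace :=
    AddMonoidHom.map_trace f.toAddMonoidHom X
  have hconst : (constMatrix (SchwingerAlgebra p) S).map (eval s : SchwingerAlgebra p →+* ℂ) =
      S.map Complex.ofRealHom := by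
    ext i j
    simp [constMatrix]
  have hquad : eval s ((F.loopMatrix coord)⁻¹ * (F.mixedMatrix coord *
      constMatrix (SchwingerAlgebra p) S * (F.mixedMatrix coord).transpose)).trace =
        (((F.quadMatrix s.1)⁻¹ *
          (F.linMatrix s.1 * S * (F.linMatrix s.1).transpose)).trace : ℝ) := by
    refine (htrace (eval s : SchwingerAlgebra p →+* ℂ) _).trans
      (Eq.trans ?_ (AddMonoidHom.map_trace Complex.ofRealHom.toAddMonoidHom _).symm)
    congr 1
    simp only [Matrix.map_mul, Matrix.transpose_map, map_eval_inv_loopMatrix, hconst,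
      map_eval_mixedMatrix, RingHom.toAddMonoidHom_eq_coe, AddMonoidHom.coe_coe]
  rw [smoothExponent, map_add, hquad, F.symanzikF_div_symanzikU S M s.2]
  simp only [map_sum, map_smul, eval_coord, smul_eq_mul]

/-- The Schwinger kernel `𝒰 ^ w * exp (-i ℱ / 𝒰)` as a smooth function. -/
def smoothModel (w : ℂ) : KernelModel F S M w (SchwingerAlgebra p) where
  d := pd
  d_comm a b f := derivAlong_comm _ _ f
  x := coord
  d_x := pd_coord
  G := (F.loopMatrix coord)⁻¹
  A_mul_G := Matrix.mul_nonsing_inv _ F.isUnit_det_loopMatrix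
  E := exp (w • log (F.loopMatrix coord).det F.eval_det_loopMatrix_mem_slitPlane -
    Complex.I • F.smoothExponent S M)
  d_E a := by
    have hlog : (F.loopMatrix coord)⁻¹.det * pd a (F.loopMatrix coord).det =
        pd a (log (F.loopMatrix coord).det F.eval_det_loopMatrix_mem_slitPlane) := by
      rw [pd, ← mul_derivAlong_log _ _ F.eval_det_loopMatrix_mem_slitPlane, ← mul_assoc,
        Matrix.det_nonsing_inv_mul_det _ F.isUnit_det_loopMatrix, one_mul]
    rw [hlog, ← smoothExponent, ← Derivation.map_smul, ← Derivation.map_smul, ← map_sub, pd,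
      derivAlong_exp]

theorem eval_E_smoothModel (D : ℂ) (s : openOrthant p) :
    eval s (F.smoothModel S M (-D / 2)).E = F.schwingerKernel S M D s.1 := by
  rw [schwingerKernel, Complex.cpow_def_of_ne_zero (F.ofReal_symanzikU_ne_zero s.2),
    ← Complex.exp_add, smoothModel, eval_exp, map_sub, map_smul, map_smul, eval_log,
    eval_smoothExponent, eval_det_loopMatrix, smul_eq_mul, smul_eq_mul, neg_mul, ← sub_eq_add_neg,
    mul_comm (-D / 2)]

theorem eval_det_G_smoothModel (w : ℂ) (s : openOrthant p) :
    eval s (F.smoothModel S M w).G.det = (F.symanzikU s.1 : ℂ)⁻¹ := by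
  have h := congrArg (eval s) (F.smoothModel S M w).det_A_mul_det_G
  rw [map_mul, map_one] at h
  rw [← F.eval_det_loopMatrix s]
  exact eq_inv_of_mul_eq_one_right h

theorem eval_E_mul_det_G_smoothModel (D : ℂ) (s : openOrthant p) :
    eval s ((F.smoothModel S M (-D / 2)).E * (F.smoothModel S M (-D / 2)).G.det) =
      F.schwingerKernel S M (D + 2) s.1 := by
  rw [map_mul, eval_E_smoothModel, eval_det_G_smoothModel, schwingerKernel, schwingerKernel,
    mul_right_comm, ← Complex.cpow_neg_one,
    ← Complex.cpow_add _ _ (F.ofReal_symanzikU_ne_zero s.2)]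
  congr 3
  ring

end CompleteFamily

theorem derivation_aeval {σ R : Type*} [DecidableEq σ] [CommRing R] [Algebra ℂ R] {x : σ → R}
    {a : σ} {d : Derivation ℂ R R} (hd : ∀ b, d (x b) = if a = b then 1 else 0)
    (P : MvPolynomial σ ℂ) :
    d (MvPolynomial.aeval x P) = MvPolynomial.aeval x (MvPolynomial.pderiv a P) := by
  induction P using MvPolynomial.induction_on with
  | C c => simp
  | add P Q hP hQ => simp only [map_add, hP, hQ]
  | mul_X P b hP =>
    simp only [map_mul, Derivation.leibniz, MvPolynomial.aeval_X, hP, hd, smul_eq_mul, map_add,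
      MvPolynomial.pderiv_X, Pi.single_apply, eq_comm (a := b)]
    split_ifs <;> simp

namespace CompleteFamily

variable {L n p : ℕ} (F : CompleteFamily L n p)

/-- The first Symanzik polynomial `𝒰` as a formal polynomial. -/
def polyU : MvPolynomial (Fin p) ℂ := (F.loopMatrix MvPolynomial.X).det

/-- The numerator over `𝒰` of the trace part of `ℱ / 𝒰`, as a formal polynomial. -/
def polyTrace (S : Matrix (Fin n) (Fin n) ℝ) : MvPolynomial (Fin p) ℂ :=
  let X : Fin p → MvPolynomial (Fin p) ℂ := MvPolynomial.X
  ((F.loopMatrix X).adjugate *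
    (F.mixedMatrix X * constMatrix (MvPolynomial (Fin p) ℂ) S * (F.mixedMatrix X).transpose)).trace

/-- The polynomial part of `ℱ / 𝒰`, as a formal polynomial. -/
def polyMass (S : Matrix (Fin n) (Fin n) ℝ) (M : Fin p → ℂ) : MvPolynomial (Fin p) ℂ :=
  ∑ b, (M b - F.extSq S b) • MvPolynomial.X b

variable {R : Type*} [CommRing R] [Algebra ℂ R] (x : Fin p → R)

theorem map_aeval_loopMatrix_X : (F.loopMatrix MvPolynomial.X).map
    (MvPolynomial.aeval x : MvPolynomial (Fin p) ℂ →ₐ[ℂ] R) = F.loopMatrix x := by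
  refine (F.map_loopMatrix (MvPolynomial.aeval x : MvPolynomial (Fin p) ℂ →ₐ[ℂ] R).toRingHom
    MvPolynomial.X).trans (congrArg F.loopMatrix (funext fun a => ?_))
  exact MvPolynomial.aeval_X x a

theorem map_aeval_mixedMatrix_X : (F.mixedMatrix MvPolynomial.X).map
    (MvPolynomial.aeval x : MvPolynomial (Fin p) ℂ →ₐ[ℂ] R) = F.mixedMatrix x := by
  refine (F.map_mixedMatrix (MvPolynomial.aeval x : MvPolynomial (Fin p) ℂ →ₐ[ℂ] R).toRingHom
    MvPolynomial.X).trans (congrArg F.mixedMatrix (funext fun a => ?_))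
  exact MvPolynomial.aeval_X x a

theorem aeval_polyU : MvPolynomial.aeval x F.polyU = (F.loopMatrix x).det := by
  rw [polyU, AlgHom.map_det, AlgHom.mapMatrix_apply, map_aeval_loopMatrix_X]

theorem aeval_polyTrace (S : Matrix (Fin n) (Fin n) ℝ) :
    MvPolynomial.aeval x (F.polyTrace S) = ((F.loopMatrix x).adjugate *
      (F.mixedMatrix x * constMatrix R S * (F.mixedMatrix x).transpose)).trace := by
  have hconst : (constMatrix (MvPolynomial (Fin p) ℂ) S).map
      (MvPolynomial.aeval x : MvPolynomial (Fin p) ℂ →ₐ[ℂ] R) = constMatrix R S := by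
    ext i j
    simp [constMatrix]
  rw [polyTrace, AddMonoidHom.map_trace, Matrix.map_mul, ← AlgHom.mapMatrix_apply,
    AlgHom.map_adjugate, AlgHom.mapMatrix_apply, map_aeval_loopMatrix_X, Matrix.map_mul,
    Matrix.map_mul, Matrix.transpose_map, map_aeval_mixedMatrix_X, hconst]

theorem aeval_polyMass (S : Matrix (Fin n) (Fin n) ℝ) (M : Fin p → ℂ) :
    MvPolynomial.aeval x (F.polyMass S M) = ∑ b, (M b - F.extSq S b) • x b := by
  simp only [polyMass, map_sum, map_smul, MvPolynomial.aeval_X]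

end CompleteFamily

namespace KernelModel

variable {L n p : ℕ} {F : CompleteFamily L n p} {S : Matrix (Fin n) (Fin n) ℝ}
  {M : Fin p → ℂ} {w : ℂ} {R : Type*} [CommRing R] [Algebra ℂ R] (K : KernelModel F S M w R)

theorem d_aeval (a : Fin p) (P : MvPolynomial (Fin p) ℂ) :
    K.d a (MvPolynomial.aeval K.x P) = MvPolynomial.aeval K.x (MvPolynomial.pderiv a P) :=
  derivation_aeval (K.d_x a) P

theorem G_eq_smul_adjugate : K.G = K.G.det • K.A.adjugate := by
  calc K.G = K.G.det • ((K.A.adjugate * K.A) * K.G) := by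
        rw [Matrix.adjugate_mul, smul_mul_assoc, one_mul, smul_smul, mul_comm,
          K.det_A_mul_det_G, one_smul]
    _ = K.G.det • K.A.adjugate := by rw [mul_assoc, K.A_mul_G, mul_one]

theorem tau_eq_det_G_mul : K.tau = K.G.det * MvPolynomial.aeval K.x (F.polyTrace S) := by
  rw [tau, F.aeval_polyTrace, ← smul_eq_mul K.G.det, ← Matrix.trace_smul, ← smul_mul_assoc,
    ← G_eq_smul_adjugate]

theorem d_det_G (a : Fin p) : K.d a K.G.det = -K.G.det ^ 2 * K.d a K.A.det :=
  (K.d a).leibniz_of_mul_eq_one ((mul_comm _ _).trans K.det_A_mul_det_G)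

theorem d_det_G_pow (a : Fin p) (k : ℕ) :
    K.d a (K.G.det ^ k) = -(k : R) * K.G.det ^ (k + 1) * K.d a K.A.det := by
  rw [Derivation.leibniz_pow, d_det_G]
  cases k with
  | zero => simp
  | succ m => simp only [Nat.add_sub_cancel, nsmul_eq_mul, smul_eq_mul]; ring

theorem d_E_mul_det_G_pow_mul (a : Fin p) (k : ℕ) (f : R) :
    K.d a (K.E * K.G.det ^ k * f) = K.E * K.G.det ^ (k + 2) *
      ((algebraMap ℂ R w - k) * K.A.det * K.d a K.A.det * f + K.A.det ^ 2 * K.d a f -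
        algebraMap ℂ R Complex.I *
          (K.A.det ^ 2 * K.d a (MvPolynomial.aeval K.x (F.polyMass S M)) +
            K.A.det * K.d a (MvPolynomial.aeval K.x (F.polyTrace S)) -
              K.d a K.A.det * MvPolynomial.aeval K.x (F.polyTrace S)) * f) := by
  have hgu : K.G.det * K.A.det = 1 := (mul_comm _ _).trans K.det_A_mul_det_G
  have hgu2 : K.G.det ^ 2 * K.A.det ^ 2 = 1 := by rw [← mul_pow, hgu, one_pow]
  have hE : K.d a K.E = K.E * (w • (K.G.det * K.d a K.A.det) -
      Complex.I • (K.d a (MvPolynomial.aeval K.x (F.polyMass S M)) +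
        K.d a (K.G.det * MvPolynomial.aeval K.x (F.polyTrace S)))) := by
    rw [← tau_eq_det_G_mul, ← map_add, F.aeval_polyMass]
    exact K.d_E a
  rw [Derivation.leibniz, Derivation.leibniz, d_det_G_pow, hE, Derivation.leibniz, d_det_G]
  simp only [smul_eq_mul, Algebra.smul_def]
  linear_combination
    (-(K.E * K.G.det ^ k * K.d a f) + algebraMap ℂ R Complex.I * f * K.E * K.G.det ^ k *
      K.d a (MvPolynomial.aeval K.x (F.polyMass S M))) * hgu2 +
    (-(algebraMap ℂ R w * f * K.E * K.G.det ^ (k + 1) * K.d a K.A.det) +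
      algebraMap ℂ R Complex.I * f * K.E * K.G.det ^ (k + 1) *
        K.d a (MvPolynomial.aeval K.x (F.polyTrace S)) +
      k * K.E * f * K.G.det ^ (k + 1) * K.d a K.A.det) * hgu

/-- The multiples of the kernel by a polynomial divided by the `k`-th power of `𝒰`. -/
def kernelMultiples (k : ℕ) : Submodule ℂ R :=
  LinearMap.range (LinearMap.mulLeft ℂ (K.E * K.G.det ^ k) ∘ₗ
    (MvPolynomial.aeval K.x : MvPolynomial (Fin p) ℂ →ₐ[ℂ] R).toLinearMap)

variable {K}

theorem mem_kernelMultiples {k : ℕ} {f : R} :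
    f ∈ K.kernelMultiples k ↔
      ∃ P : MvPolynomial (Fin p) ℂ, K.E * K.G.det ^ k * MvPolynomial.aeval K.x P = f :=
  Iff.rfl

variable (K) in
theorem E_mem_kernelMultiples : K.E ∈ K.kernelMultiples 0 :=
  mem_kernelMultiples.mpr ⟨1, by simp⟩

theorem d_mem_kernelMultiples {k : ℕ} {f : R} (hf : f ∈ K.kernelMultiples k) (a : Fin p) :
    K.d a f ∈ K.kernelMultiples (k + 2) := by
  obtain ⟨P, rfl⟩ := mem_kernelMultiples.mp hf
  refine mem_kernelMultiples.mpr ⟨(MvPolynomial.C w - (k : MvPolynomial (Fin p) ℂ)) * F.polyU *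
      MvPolynomial.pderiv a F.polyU * P + F.polyU ^ 2 * MvPolynomial.pderiv a P -
    MvPolynomial.C Complex.I * (F.polyU ^ 2 * MvPolynomial.pderiv a (F.polyMass S M) +
      F.polyU * MvPolynomial.pderiv a (F.polyTrace S) -
        MvPolynomial.pderiv a F.polyU * F.polyTrace S) * P, ?_⟩
  simp only [d_E_mul_det_G_pow_mul, d_aeval, map_sub, map_add, map_mul, map_pow, map_natCast,
    MvPolynomial.aeval_C, ← F.aeval_polyU]

end KernelModel

@[elab_as_elim]
theorem finsupp_induction_add_single_one {σ : Type*} {motive : (σ →₀ ℕ) → Prop} (m : σ →₀ ℕ)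
    (zero : motive 0)
    (add_single_one : ∀ m a, motive m → motive (m + Finsupp.single a 1)) : motive m := by
  have add_single (m : σ →₀ ℕ) (a : σ) (r : ℕ) (hm : motive m) :
      motive (m + Finsupp.single a r) := by
    induction r with
    | zero => simpa using hm
    | succ r ih => simpa [add_assoc] using add_single_one _ a ih
  induction m using Finsupp.induction with
  | zero => exact zero
  | single_add a r m _ _ hm => rw [add_comm]; exact add_single m a r hm

theorem sum_nonneg_of_mem_orthant {p : ℕ} {s : Fin p → ℝ} (hs : s ∈ orthant p) : 0 ≤ ∑ a, s a :=
  Finset.sum_nonneg fun a _ => (hs a).le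

theorem rpow_mul_inv_pow_le {u : ℝ} (hu : 0 < u) {r : ℝ} {k : ℕ} (hk : k ≤ r) :
    u ^ r * u⁻¹ ^ k ≤ (1 + u) ^ ⌈r - k⌉₊ := by
  rw [inv_pow, ← div_eq_mul_inv, ← Real.rpow_sub_natCast hu.ne', ← Real.rpow_natCast (1 + u)]
  calc u ^ (r - k) ≤ (1 + u) ^ (r - k) := Real.rpow_le_rpow hu.le (by linarith) (by linarith)
    _ ≤ (1 + u) ^ (⌈r - k⌉₊ : ℝ) :=
        Real.rpow_le_rpow_of_exponent_le (by linarith) (Nat.le_ceil _)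

namespace SchwingerAlgebra

open smoothAlgebra

variable {p : ℕ}

/-- The smooth functions of positive Schwinger parameters that decay exponentially at infinity. -/
def expDecaying (p : ℕ) : Submodule ℂ (SchwingerAlgebra p) where
  carrier := {f | ∃ C c : ℝ, 0 ≤ C ∧ 0 < c ∧
    ∀ s : openOrthant p, ‖eval s f‖ ≤ C * Real.exp (-c * ∑ a, s.1 a)}
  zero_mem' := ⟨0, 1, le_rfl, one_pos, fun s => by simp⟩
  add_mem' := by
    rintro f g ⟨C₁, c₁, hC₁, hc₁, hf⟩ ⟨C₂, c₂, hC₂, hc₂, hg⟩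
    refine ⟨C₁ + C₂, min c₁ c₂, add_nonneg hC₁ hC₂, lt_min hc₁ hc₂, fun s => ?_⟩
    have hs := sum_nonneg_of_mem_orthant s.2
    rw [map_add, add_mul]
    refine (norm_add_le _ _).trans (add_le_add ((hf s).trans ?_) ((hg s).trans ?_))
    · gcongr
      exact min_le_left _ _
    · gcongr
      exact min_le_right _ _
  smul_mem' := by
    rintro z f ⟨C, c, hC, hc, hf⟩
    refine ⟨‖z‖ * C, c, by positivity, hc, fun s => ?_⟩
    rw [map_smul, norm_smul, mul_assoc]
    gcongr
    exact hf s

theorem expDecaying_of_norm_eval_le {f g : SchwingerAlgebra p} (hg : g ∈ expDecaying p)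
    (hfg : ∀ s, ‖eval s f‖ ≤ ‖eval s g‖) : f ∈ expDecaying p :=
  let ⟨C, c, hC, hc, hle⟩ := hg
  ⟨C, c, hC, hc, fun s => (hfg s).trans (hle s)⟩

theorem norm_eval_coord (a : Fin p) (s : openOrthant p) : ‖eval s (coord a)‖ = s.1 a := by
  rw [eval_coord, Complex.norm_real, Real.norm_of_nonneg (s.2 a).le]

theorem coord_mul_mem_expDecaying (a : Fin p) {f : SchwingerAlgebra p} (hf : f ∈ expDecaying p) :
    coord a * f ∈ expDecaying p := by
  obtain ⟨C, c, hC, hc, hle⟩ := hf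
  refine ⟨2 / c * C, c / 2, by positivity, half_pos hc, fun s => ?_⟩
  set r := ∑ b, s.1 b
  have hcoord : s.1 a ≤ r :=
    Finset.single_le_sum (f := s.1) (fun b _ => (s.2 b).le) (Finset.mem_univ a)
  have hexp : r ≤ 2 / c * Real.exp (c / 2 * r) := by
    have h := (le_add_of_nonneg_right zero_le_one).trans (Real.add_one_le_exp (c / 2 * r))
    calc r = 2 / c * (c / 2 * r) := by field_simp
      _ ≤ 2 / c * Real.exp (c / 2 * r) := by gcongr
  rw [map_mul, norm_mul, norm_eval_coord]
  calc s.1 a * ‖eval s f‖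
      ≤ 2 / c * Real.exp (c / 2 * r) * (C * Real.exp (-c * r)) :=
        mul_le_mul (hcoord.trans hexp) (hle s) (norm_nonneg _) (by positivity)
    _ = 2 / c * C * Real.exp (-(c / 2) * r) := by
        rw [mul_mul_mul_comm, ← Real.exp_add]
        congr 2
        ring

theorem aeval_coord_mul_mem_expDecaying (P : MvPolynomial (Fin p) ℂ) {f : SchwingerAlgebra p}
    (hf : f ∈ expDecaying p) : MvPolynomial.aeval coord P * f ∈ expDecaying p := by
  induction P using MvPolynomial.induction_on with
  | C c =>
    rw [MvPolynomial.aeval_C, ← Algebra.smul_def]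
    exact Submodule.smul_mem _ c hf
  | add P Q hP hQ =>
    rw [map_add, add_mul]
    exact Submodule.add_mem _ hP hQ
  | mul_X P a hP =>
    rw [map_mul, MvPolynomial.aeval_X, mul_comm _ (coord a), mul_assoc]
    exact coord_mul_mem_expDecaying a hP

theorem norm_eval_exp_neg_smul_sum_coord (c : ℝ) (s : openOrthant p) :
    ‖eval s (exp (-(c : ℂ) • ∑ a, coord a))‖ = Real.exp (-c * ∑ a, s.1 a) := by
  simp only [eval_exp, map_smul, map_sum, eval_coord, Complex.norm_exp, smul_eq_mul,
    ← Complex.ofReal_sum, ← Complex.ofReal_neg, ← Complex.ofReal_mul, Complex.ofReal_re]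

theorem exp_neg_smul_sum_coord_mem_expDecaying {c : ℝ} (hc : 0 < c) :
    exp (-(c : ℂ) • ∑ a, coord a) ∈ expDecaying p :=
  ⟨1, c, zero_le_one, hc, fun s => by rw [norm_eval_exp_neg_smul_sum_coord, one_mul]⟩

/-- The smooth functions of positive Schwinger parameters whose partial derivatives of order at
most `N` decay exponentially at infinity. -/
def expDecayingDerivs (p : ℕ) : ℕ → Submodule ℂ (SchwingerAlgebra p)
  | 0 => expDecaying p
  | N + 1 => expDecaying p ⊓ ⨅ a, (expDecayingDerivs p N).comap (pd a).toLinearMap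

theorem mem_expDecayingDerivs_succ {N : ℕ} {f : SchwingerAlgebra p} :
    f ∈ expDecayingDerivs p (N + 1) ↔
      f ∈ expDecaying p ∧ ∀ a, pd a f ∈ expDecayingDerivs p N := by
  simp only [expDecayingDerivs, Submodule.mem_inf, Submodule.mem_iInf, Submodule.mem_comap]
  rfl

theorem expDecayingDerivs_antitone : Antitone (expDecayingDerivs p) := by
  refine antitone_nat_of_succ_le fun N => ?_
  induction N with
  | zero => exact inf_le_left
  | succ N ih =>
    exact fun f hf => mem_expDecayingDerivs_succ.mpr ((mem_expDecayingDerivs_succ.mp hf).imp_right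
      fun h a => ih (h a))

/-- The representation `X a ↦ i * ∂ / ∂ s_a` of polynomials by differential operators. -/
def op : MvPolynomial (Fin p) ℂ →ₐ[ℂ] Module.End ℂ (SchwingerAlgebra p) :=
  diffOp pd fun _ _ => derivAlong_comm _ _

theorem op_mul (P Q : MvPolynomial (Fin p) ℂ) (f : SchwingerAlgebra p) :
    op (P * Q) f = op P (op Q f) :=
  diffOp_mul _ _ P Q f

theorem op_X (a : Fin p) (f : SchwingerAlgebra p) :
    op (MvPolynomial.X a) f = Complex.I • pd a f :=
  diffOp_X _ _ a f

theorem op_monomial_add (m₁ m₂ : Fin p →₀ ℕ) (f : SchwingerAlgebra p) :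
    op (MvPolynomial.monomial (m₁ + m₂) 1) f =
      op (MvPolynomial.monomial m₁ 1) (op (MvPolynomial.monomial m₂ 1) f) := by
  rw [← op_mul, MvPolynomial.monomial_mul, one_mul]

theorem op_monomial_single_one (a : Fin p) (f : SchwingerAlgebra p) :
    op (MvPolynomial.monomial (Finsupp.single a 1) 1) f = Complex.I • pd a f :=
  op_X a f

theorem op_monomial_zero (f : SchwingerAlgebra p) : op (MvPolynomial.monomial 0 1) f = f := by
  rw [← MvPolynomial.one_def, map_one, Module.End.one_apply]

theorem op_monomial_mem_expDecayingDerivs (m : Fin p →₀ ℕ) {N : ℕ} {f : SchwingerAlgebra p}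
    (hf : f ∈ expDecayingDerivs p (N + m.degree)) :
    op (MvPolynomial.monomial m 1) f ∈ expDecayingDerivs p N := by
  induction m using finsupp_induction_add_single_one generalizing N f with
  | zero => simpa [op_monomial_zero] using hf
  | add_single_one m a hm =>
    rw [op_monomial_add, op_monomial_single_one]
    refine hm (Submodule.smul_mem _ _ ?_)
    rw [map_add, Finsupp.degree_single, ← add_assoc] at hf
    exact (mem_expDecayingDerivs_succ.mp hf).2 a

end SchwingerAlgebra

namespace CompleteFamily

open smoothAlgebra SchwingerAlgebra

variable {L n p : ℕ} {F : CompleteFamily L n p} {S : Matrix (Fin n) (Fin n) ℝ} {M : Fin p → ℂ}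

theorem norm_schwingerKernel {η : ℝ} (hM : ∀ a, (M a).im = -η) (D : ℂ) {s : Fin p → ℝ}
    (hs : s ∈ orthant p) :
    ‖F.schwingerKernel S M D s‖ = F.symanzikU s ^ (-D / 2).re * Real.exp (-η * ∑ a, s a) := by
  have hU := F.ofReal_symanzikU_ne_zero hs
  have hexponent : F.symanzikF S M s / F.symanzikU s =
      (∑ a, M a * s a) + ((F.symanzikFtilde S s / F.symanzikU s : ℝ) : ℂ) := by
    rw [symanzikF]
    push_cast
    field_simp
  have him : (∑ a, M a * s a).im = -η * ∑ a, s a := by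
    simp only [Complex.im_sum, Complex.im_mul_ofReal, hM, Finset.mul_sum]
  rw [schwingerKernel, norm_mul, Complex.norm_cpow_eq_rpow_re_of_pos (F.symanzikU_pos hs),
    Complex.norm_exp, hexponent, neg_mul, Complex.neg_re, Complex.I_mul_re, neg_neg,
    Complex.add_im, Complex.ofReal_im, add_zero, him]

section Decay

variable {η : ℝ} (hη : 0 < η) (hM : ∀ a, (M a).im = -η) {D : ℂ}
include hη hM

theorem kernelMultiples_le_expDecaying {k : ℕ} (hk : k ≤ (-D / 2).re) :
    (F.smoothModel S M (-D / 2)).kernelMultiples k ≤ expDecaying p := by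
  rintro _ ⟨P, rfl⟩
  set m := ⌈(-D / 2).re - k⌉₊
  refine expDecaying_of_norm_eval_le (aeval_coord_mul_mem_expDecaying ((1 + F.polyU) ^ m * P)
    (exp_neg_smul_sum_coord_mem_expDecaying hη)) fun s => ?_
  set u := F.symanzikU s.1
  set q : ℂ := eval s (MvPolynomial.aeval coord P)
  have hu : 0 < u := F.symanzikU_pos s.2
  have hleft : ‖eval s ((F.smoothModel S M (-D / 2)).E * (F.smoothModel S M (-D / 2)).G.det ^ k *
      MvPolynomial.aeval coord P)‖ =
        u ^ (-D / 2).re * u⁻¹ ^ k * (‖q‖ * Real.exp (-η * ∑ a, s.1 a)) := by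
    rw [map_mul, map_mul, map_pow, norm_mul, norm_mul, norm_pow, F.eval_E_smoothModel,
      F.eval_det_G_smoothModel, norm_schwingerKernel hM D s.2, norm_inv, Complex.norm_real,
      Real.norm_of_nonneg hu.le]
    ring
  have hright : ‖eval s (MvPolynomial.aeval coord ((1 + F.polyU) ^ m * P) *
      exp (-(η : ℂ) • ∑ a, coord a))‖ =
        (1 + u) ^ m * (‖q‖ * Real.exp (-η * ∑ a, s.1 a)) := by
    rw [map_mul, map_mul, map_pow, map_add, map_one, F.aeval_polyU, map_mul, map_pow, map_add,
      map_one, F.eval_det_loopMatrix, norm_mul, norm_mul, norm_pow,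
      norm_eval_exp_neg_smul_sum_coord, ← Complex.ofReal_one, ← Complex.ofReal_add,
      Complex.norm_real, Real.norm_of_nonneg (by positivity), mul_assoc]
  refine hleft.trans_le (le_of_le_of_eq ?_ hright.symm)
  gcongr
  exact rpow_mul_inv_pow_le hu hk

theorem kernelMultiples_le_expDecayingDerivs {k N : ℕ}
    (hN : ((k + 2 * N : ℕ) : ℝ) ≤ (-D / 2).re) :
    (F.smoothModel S M (-D / 2)).kernelMultiples k ≤ expDecayingDerivs p N := by
  have hk : (k : ℝ) ≤ (-D / 2).re := le_trans (by push_cast; linarith) hN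
  induction N generalizing k with
  | zero => exact kernelMultiples_le_expDecaying hη hM hk
  | succ N ih =>
    refine fun f hf => mem_expDecayingDerivs_succ.mpr
      ⟨kernelMultiples_le_expDecaying hη hM hk hf, fun a => ?_⟩
    refine ih ?_ ?_ (KernelModel.d_mem_kernelMultiples hf a)
    · convert hN using 2
      ring
    · exact le_trans (by push_cast; linarith) hN

theorem E_smoothModel_mem_expDecayingDerivs {N : ℕ} (hN : ((2 * N : ℕ) : ℝ) ≤ (-D / 2).re) :
    (F.smoothModel S M (-D / 2)).E ∈ expDecayingDerivs p N :=
  kernelMultiples_le_expDecayingDerivs hη hM (by rwa [zero_add])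
    (KernelModel.E_mem_kernelMultiples _)

end Decay

end CompleteFamily

section OrthantIntegrals

open smoothAlgebra SchwingerAlgebra

variable {p : ℕ}

theorem measurableSet_orthant (p : ℕ) : MeasurableSet (orthant p) :=
  (isOpen_orthant p).measurableSet

theorem integrableOn_exp_neg_mul_sum_orthant (p : ℕ) {c : ℝ} (hc : 0 < c) :
    IntegrableOn (fun s : Fin p → ℝ => Real.exp (-c * ∑ a, s a)) (orthant p) := by
  have horthant : orthant p = Set.univ.pi fun _ => Set.Ioi 0 := by
    ext s
    simp [orthant]
  simp only [IntegrableOn, horthant, volume_pi, Measure.restrict_pi_pi, Finset.mul_sum,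
    Real.exp_sum]
  exact Integrable.fintype_prod fun _ => integrableOn_exp_mul_Ioi (neg_lt_zero.mpr hc) 0

theorem SchwingerAlgebra.integrableOn_extend {f : SchwingerAlgebra p} (hf : f ∈ expDecaying p) :
    IntegrableOn (extend f) (orthant p) := by
  obtain ⟨C, c, -, hc, hle⟩ := hf
  refine Integrable.mono' ((integrableOn_exp_neg_mul_sum_orthant p hc).const_mul C)
    ((contDiffOn_extend f).continuousOn.aestronglyMeasurable (measurableSet_orthant p)) ?_
  filter_upwards [ae_restrict_mem (measurableSet_orthant p)] with s hs
  rw [extend_coe f ⟨s, hs⟩]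
  exact hle ⟨s, hs⟩

theorem tendsto_mul_exp_neg_mul_atTop {c : ℝ} (hc : 0 < c) (C : ℝ) :
    Tendsto (fun t : ℝ => t * (C * Real.exp (-c * t))) atTop (𝓝 0) := by
  have h := ((Real.tendsto_pow_mul_exp_neg_atTop_nhds_zero 1).comp
    (tendsto_id.const_mul_atTop hc)).const_mul (C / c)
  rw [mul_zero] at h
  refine h.congr fun t => ?_
  simp only [Function.comp_apply, id, pow_one, neg_mul]
  field_simp

theorem integral_Ioi_eq_zero_of_hasDerivAt {φ φ' : ℝ → ℂ} {C c : ℝ} (hc : 0 < c)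
    (hderiv : ∀ t, 0 < t → HasDerivAt φ (φ' t) t)
    (hle : ∀ t, 0 ≤ t → ‖φ t‖ ≤ t * (C * Real.exp (-c * t))) :
    ∫ t in Set.Ioi 0, φ' t = 0 := by
  by_cases hint : IntegrableOn φ' (Set.Ioi 0)
  swap
  · exact integral_undef hint
  have hzero : φ 0 = 0 := norm_le_zero_iff.mp (by simpa using hle 0 le_rfl)
  have hcont : ContinuousWithinAt φ (Set.Ici 0) 0 := by
    have hbound : Continuous fun t : ℝ => t * (C * Real.exp (-c * t)) := by fun_prop
    rw [ContinuousWithinAt, hzero]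
    refine squeeze_zero_norm' (eventually_nhdsWithin_of_forall hle) ?_
    simpa using (hbound.tendsto 0).mono_left (nhdsWithin_le_nhds (s := Set.Ici 0))
  have htop : Tendsto φ atTop (𝓝 0) := by
    refine squeeze_zero_norm' ?_ (tendsto_mul_exp_neg_mul_atTop hc C)
    filter_upwards [eventually_ge_atTop 0] with t ht using hle t ht
  rw [integral_Ioi_of_hasDerivAt_of_tendsto hcont hderiv hint htop, hzero, sub_zero]

theorem insertNth_mem_orthant (a : Fin (p + 1)) (t : ℝ) (y : Fin p → ℝ) :
    a.insertNth t y ∈ orthant (p + 1) ↔ 0 < t ∧ y ∈ orthant p := by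
  change (∀ b, 0 < (a.insertNth t y : Fin (p + 1) → ℝ) b) ↔ _
  rw [Fin.forall_iff_succAbove a]
  simp [orthant]

theorem norm_extend_coord_mul_insertNth_le {f : SchwingerAlgebra (p + 1)} {C c : ℝ}
    (hC : 0 ≤ C) (hc : 0 < c)
    (hf : ∀ s : openOrthant (p + 1), ‖eval s f‖ ≤ C * Real.exp (-c * ∑ b, s.1 b))
    (a : Fin (p + 1)) {y : Fin p → ℝ} (hy : y ∈ orthant p) {t : ℝ} (ht : 0 ≤ t) :
    ‖extend (coord a * f) (a.insertNth t y)‖ ≤ t * (C * Real.exp (-c * t)) := by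
  rcases ht.eq_or_lt with rfl | ht
  · rw [extend_of_notMem]
    · simp
    · exact fun h => lt_irrefl _ ((insertNth_mem_orthant a _ y).mp h).1
  let s : openOrthant (p + 1) := ⟨a.insertNth t y, (insertNth_mem_orthant a t y).mpr ⟨ht, hy⟩⟩
  have hsum : t ≤ ∑ b, s.1 b := by
    rw [Fin.sum_univ_succAbove _ a]
    simp only [s, Fin.insertNth_apply_same, Fin.insertNth_apply_succAbove]
    exact le_add_of_nonneg_right (sum_nonneg_of_mem_orthant hy)
  have hcoord : s.1 a = t := Fin.insertNth_apply_same (α := fun _ => ℝ) a t y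
  rw [show a.insertNth t y = (s : Fin (p + 1) → ℝ) from rfl, extend_coe, map_mul, norm_mul,
    norm_eval_coord, hcoord]
  refine mul_le_mul_of_nonneg_left ((hf s).trans ?_) ht.le
  refine mul_le_mul_of_nonneg_left (Real.exp_le_exp.mpr ?_) hC
  exact mul_le_mul_of_nonpos_left hsum (neg_nonpos.mpr hc.le)

theorem integral_pd_coord_mul_insertNth {f : SchwingerAlgebra (p + 1)}
    (hf : f ∈ expDecaying (p + 1)) (a : Fin (p + 1)) (y : Fin p → ℝ) :
    ∫ t : ℝ, extend (pd a (coord a * f)) (a.insertNth t y) = 0 := by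
  by_cases hy : y ∈ orthant p
  swap
  · refine integral_eq_zero_of_ae (Eventually.of_forall fun t => extend_of_notMem _ ?_)
    exact fun h => hy ((insertNth_mem_orthant a t y).mp h).2
  obtain ⟨C, c, hC, hc, hle⟩ := hf
  rw [← setIntegral_eq_integral_of_forall_compl_eq_zero (s := Set.Ioi 0) fun t ht =>
    extend_of_notMem _ fun h => ht ((insertNth_mem_orthant a t y).mp h).1]
  refine integral_Ioi_eq_zero_of_hasDerivAt (φ := fun t => extend (coord a * f) (a.insertNth t y))
    hc (fun t ht => ?_) fun t ht => norm_extend_coord_mul_insertNth_le hC hc hle a hy ht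
  let s : openOrthant (p + 1) := ⟨a.insertNth t y, (insertNth_mem_orthant a t y).mpr ⟨ht, hy⟩⟩
  have h := SchwingerAlgebra.hasDerivAt_update a (coord a * f) s
  rw [← extend_coe] at h
  simpa only [s, Fin.update_insertNth, Fin.insertNth_apply_same] using h

theorem integral_pd_coord_mul {f : SchwingerAlgebra p} (hf : f ∈ expDecaying p) (a : Fin p) :
    ∫ s in orthant p, extend (pd a (coord a * f)) s = 0 := by
  obtain _ | p := p
  · exact a.elim0
  rw [setIntegral_eq_integral_of_forall_compl_eq_zero (s := orthant (p + 1)) fun s hs =>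
    extend_of_notMem _ hs]
  by_cases hint : Integrable (extend (pd a (coord a * f)))
  swap
  · exact integral_undef hint
  have hpreserving := (volume_preserving_piFinSuccAbove (fun _ : Fin (p + 1) => ℝ) a).symm
  have hint' := (hpreserving.integrable_comp_emb
    (MeasurableEquiv.measurableEmbedding _)).mpr hint
  rw [← hpreserving.integral_comp']
  rw [Measure.volume_eq_prod] at hint' ⊢
  exact (integral_prod_symm _ hint').trans (integral_eq_zero_of_ae
    (Eventually.of_forall fun y => integral_pd_coord_mul_insertNth hf a y))

theorem integral_pderiv_mul_eq_neg {P : MvPolynomial (Fin p) ℂ} {a : Fin p}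
    (hP : MvPolynomial.X a ∣ P) {f : SchwingerAlgebra p} (hf : f ∈ expDecayingDerivs p 1) :
    ∫ s in orthant p, extend (MvPolynomial.aeval coord (MvPolynomial.pderiv a P) * f) s =
      -∫ s in orthant p, extend (MvPolynomial.aeval coord P * pd a f) s := by
  obtain ⟨hf, hdf⟩ := mem_expDecayingDerivs_succ.mp hf
  have hboundary : ∫ s in orthant p, extend (pd a (MvPolynomial.aeval coord P * f)) s = 0 := by
    obtain ⟨Q, rfl⟩ := hP
    rw [map_mul (MvPolynomial.aeval coord), MvPolynomial.aeval_X, mul_assoc]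
    exact integral_pd_coord_mul (aeval_coord_mul_mem_expDecaying Q hf) a
  rw [eq_neg_iff_add_eq_zero, ← hboundary, Derivation.leibniz, derivation_aeval (pd_coord a),
    smul_eq_mul, smul_eq_mul, mul_comm f, add_comm (_ * pd a f), map_add]
  exact (integral_add (integrableOn_extend (aeval_coord_mul_mem_expDecaying _ hf))
    (integrableOn_extend (aeval_coord_mul_mem_expDecaying P (hdf a)))).symm

end OrthantIntegrals

section MixedPartial

open smoothAlgebra SchwingerAlgebra

variable {p : ℕ} {c : ℂ} {g : (Fin p → ℝ) → ℂ} {f : SchwingerAlgebra p}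

theorem I_mul_partialDeriv_eq_eval_op (a : Fin p) (h : ∀ s : openOrthant p, c * g s = eval s f)
    (s : openOrthant p) :
    Complex.I * c * partialDeriv a g s = eval s (op (MvPolynomial.X a) f) := by
  rw [op_X, map_smul, smul_eq_mul, ← (SchwingerAlgebra.hasDerivAt_update a f s).deriv, mul_assoc,
    partialDeriv, ← deriv_const_mul_field]
  congr 1
  refine Filter.EventuallyEq.deriv_eq ?_
  have hcont : ContinuousAt (fun t => Function.update s.1 a t) (s.1 a) := by fun_prop
  have hmem : orthant p ∈ 𝓝 (Function.update s.1 a (s.1 a)) := by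
    rw [Function.update_eq_self]
    exact (isOpen_orthant p).mem_nhds s.2
  filter_upwards [hcont.preimage_mem_nhds hmem] with t ht
  exact (h ⟨_, ht⟩).trans (extend_coe f ⟨_, ht⟩).symm

theorem I_pow_mul_iterate_partialDeriv_eq_eval_op (a : Fin p) (k : ℕ)
    (h : ∀ s : openOrthant p, c * g s = eval s f) (s : openOrthant p) :
    Complex.I ^ k * c * (partialDeriv a)^[k] g s = eval s (op (MvPolynomial.X a ^ k) f) := by
  induction k generalizing s with
  | zero => simpa using h s
  | succ k ih =>
    rw [pow_succ' Complex.I, mul_assoc Complex.I, Function.iterate_succ_apply', pow_succ', op_mul]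
    exact I_mul_partialDeriv_eq_eval_op a ih s

theorem I_pow_mul_mixedPartial_eq_eval_op (m : Fin p →₀ ℕ)
    (h : ∀ s : openOrthant p, g s = eval s f) (s : openOrthant p) :
    Complex.I ^ m.degree * mixedPartial m g s = eval s (op (MvPolynomial.monomial m 1) f) := by
  have hlist (l : List (Fin p)) (s : openOrthant p) :
      Complex.I ^ (l.map m).sum * l.foldr (fun a g => (partialDeriv a)^[m a] g) g s =
        eval s (op (l.map fun a => MvPolynomial.X a ^ m a).prod f) := by
    induction l generalizing s with
    | nil => simpa using h s
    | cons a l ih =>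
      rw [List.map_cons, List.sum_cons, pow_add, List.foldr_cons, List.map_cons, List.prod_cons,
        op_mul]
      exact I_pow_mul_iterate_partialDeriv_eq_eval_op a (m a) ih s
  rw [MvPolynomial.monomial_eq, MvPolynomial.C_1, one_mul, Finsupp.prod_fintype _ _ (by simp),
    Finsupp.degree_eq_sum, Fin.prod_univ_def, Fin.sum_univ_def]
  exact hlist (List.finRange p) s

end MixedPartial

section Pairing

open smoothAlgebra SchwingerAlgebra

variable {p : ℕ}

/-- The exponents of the Schwinger parameters in the density `∏ a, s_a ^ (ν_a - 1) / Γ(ν_a)`, where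
the factors with `ν_a ≤ 0` are omitted. -/
def densityExponent (ν : Fin p → ℤ) : Fin p →₀ ℕ :=
  Finsupp.equivFunOnFinite.symm fun a => (ν a - 1).toNat

/-- The orders of the derivatives that exponents `ν_a ≤ 0` move to the kernel. -/
def symbolExponent (ν : Fin p → ℤ) : Fin p →₀ ℕ :=
  Finsupp.equivFunOnFinite.symm fun a => (1 - ν a).toNat

/-- The exponents `ν` lowered by `m`. -/
def lower (ν : Fin p → ℤ) (m : Fin p →₀ ℕ) : Fin p → ℤ := fun a => ν a - m a

theorem lower_zero (ν : Fin p → ℤ) : lower ν 0 = ν := by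
  ext a
  simp [lower]

theorem lower_add (ν : Fin p → ℤ) (m₁ m₂ : Fin p →₀ ℕ) :
    lower ν (m₁ + m₂) = lower (lower ν m₁) m₂ := by
  ext a
  simp only [lower, Finsupp.add_apply, Nat.cast_add]
  ring

theorem degree_symbolExponent_lower_le (ν : Fin p → ℤ) (m : Fin p →₀ ℕ) :
    (symbolExponent (lower ν m)).degree ≤ (symbolExponent ν).degree + m.degree := by
  simp only [Finsupp.degree_eq_sum, ← Finset.sum_add_distrib]
  refine Finset.sum_le_sum fun a _ => ?_
  simp only [symbolExponent, Finsupp.equivFunOnFinite_symm_apply_apply, lower]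
  omega

section LowerOne

variable {ν : Fin p → ℤ} {a : Fin p}

theorem symbolExponent_lower_single_of_le_one (ha : ν a ≤ 1) :
    symbolExponent (lower ν (Finsupp.single a 1)) = symbolExponent ν + Finsupp.single a 1 := by
  ext b
  by_cases hb : b = a
  · subst hb
    simp only [symbolExponent, lower, Finsupp.equivFunOnFinite_symm_apply_apply, Finsupp.add_apply,
      Finsupp.single_eq_same]
    omega
  · simp [symbolExponent, lower, hb]

theorem densityExponent_lower_single_of_le_one (ha : ν a ≤ 1) :
    densityExponent (lower ν (Finsupp.single a 1)) = densityExponent ν := by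
  ext b
  by_cases hb : b = a
  · subst hb
    simp only [densityExponent, lower, Finsupp.equivFunOnFinite_symm_apply_apply,
      Finsupp.single_eq_same]
    omega
  · simp [densityExponent, lower, hb]

theorem symbolExponent_lower_single_of_one_lt (ha : 1 < ν a) :
    symbolExponent (lower ν (Finsupp.single a 1)) = symbolExponent ν := by
  ext b
  by_cases hb : b = a
  · subst hb
    simp only [symbolExponent, lower, Finsupp.equivFunOnFinite_symm_apply_apply,
      Finsupp.single_eq_same]
    omega
  · simp [symbolExponent, lower, hb]

theorem densityExponent_eq_lower_single_add (ha : 1 < ν a) :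
    densityExponent ν =
      densityExponent (lower ν (Finsupp.single a 1)) + Finsupp.single a 1 := by
  ext b
  by_cases hb : b = a
  · subst hb
    simp only [densityExponent, lower, Finsupp.equivFunOnFinite_symm_apply_apply, Finsupp.add_apply,
      Finsupp.single_eq_same]
    omega
  · simp [densityExponent, lower, hb]

end LowerOne

/-- The divided power `∏ a, X_a ^ m_a / m_a!`. -/
def dividedMonomial (m : Fin p →₀ ℕ) : MvPolynomial (Fin p) ℂ :=
  MvPolynomial.monomial m (∏ a, ((m a).factorial : ℂ))⁻¹

theorem X_dvd_dividedMonomial_add_single (m : Fin p →₀ ℕ) (a : Fin p) :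
    MvPolynomial.X a ∣ dividedMonomial (m + Finsupp.single a 1) :=
  MvPolynomial.X_dvd_monomial.mpr (Or.inr (by simp))

theorem pderiv_dividedMonomial_add_single (m : Fin p →₀ ℕ) (a : Fin p) :
    MvPolynomial.pderiv a (dividedMonomial (m + Finsupp.single a 1)) = dividedMonomial m := by
  have hfactorial : ∏ b, (((m + Finsupp.single a 1 : Fin p →₀ ℕ) b).factorial : ℂ) =
      (∏ b, ((m b).factorial : ℂ)) * (m a + 1) := by
    have hsucc (b : Fin p) : (((m + Finsupp.single a 1 : Fin p →₀ ℕ) b).factorial : ℂ) =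
        (m b).factorial * if b = a then (m a + 1 : ℂ) else 1 := by
      by_cases hb : b = a
      · subst hb
        simp [Nat.factorial_succ, mul_comm]
      · simp [hb]
    simp only [hsucc, Finset.prod_mul_distrib, Finset.prod_ite_eq', Finset.mem_univ, if_true]
  rw [dividedMonomial, dividedMonomial, MvPolynomial.pderiv_monomial, add_tsub_cancel_right,
    hfactorial, mul_inv, Finsupp.add_apply, Finsupp.single_eq_same, Nat.cast_add_one,
    inv_mul_cancel_right₀ (Nat.cast_add_one_ne_zero _)]

/-- The integrand of `pairing`: the Schwinger density times derivatives of `f`. -/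
def pairingIntegrand (ν : Fin p → ℤ) : Module.End ℂ (SchwingerAlgebra p) :=
  LinearMap.mulLeft ℂ (MvPolynomial.aeval coord (dividedMonomial (densityExponent ν))) ∘ₗ
    op (MvPolynomial.monomial (symbolExponent ν) 1)

/-- The integral of a smooth function against the Schwinger density for the exponents `ν`, with the
derivatives that represent exponents `ν_a ≤ 0`. The power of `i` is the product of `i ^ ν_a` and of
the factors `i` in `op`. -/
def pairing (ν : Fin p → ℤ) (f : SchwingerAlgebra p) : ℂ :=
  Complex.I ^ ((densityExponent ν).degree + p) *
    ∫ s in orthant p, extend (pairingIntegrand ν f) s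

theorem pairing_smul (ν : Fin p → ℤ) (c : ℂ) (f : SchwingerAlgebra p) :
    pairing ν (c • f) = c * pairing ν f := by
  simp only [pairing, map_smul, Pi.smul_apply, smul_eq_mul, integral_const_mul]
  ring

theorem pairingIntegrand_mem_expDecaying {ν : Fin p → ℤ} {f : SchwingerAlgebra p}
    (hf : f ∈ expDecayingDerivs p (symbolExponent ν).degree) :
    pairingIntegrand ν f ∈ expDecaying p :=
  aeval_coord_mul_mem_expDecaying _
    (op_monomial_mem_expDecayingDerivs (N := 0) _ (by rwa [zero_add]))

theorem pairing_sum {ι : Type*} (t : Finset ι) (ν : Fin p → ℤ) {f : ι → SchwingerAlgebra p}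
    (hf : ∀ i ∈ t, f i ∈ expDecayingDerivs p (symbolExponent ν).degree) :
    pairing ν (∑ i ∈ t, f i) = ∑ i ∈ t, pairing ν (f i) := by
  simp only [pairing, map_sum, Finset.sum_apply, ← Finset.mul_sum]
  rw [integral_finsetSum t fun i hi =>
    integrableOn_extend (pairingIntegrand_mem_expDecaying (hf i hi))]

theorem pairing_lower_single_of_le_one {ν : Fin p → ℤ} {a : Fin p} (ha : ν a ≤ 1)
    (f : SchwingerAlgebra p) :
    pairing (lower ν (Finsupp.single a 1)) f = pairing ν (Complex.I • pd a f) := by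
  simp only [pairing, pairingIntegrand, densityExponent_lower_single_of_le_one ha,
    symbolExponent_lower_single_of_le_one ha, LinearMap.comp_apply, op_monomial_add,
    op_monomial_single_one]

theorem pairing_lower_single_of_one_lt {ν : Fin p → ℤ} {a : Fin p} (ha : 1 < ν a)
    {f : SchwingerAlgebra p} (hf : f ∈ expDecayingDerivs p ((symbolExponent ν).degree + 1)) :
    pairing (lower ν (Finsupp.single a 1)) f = pairing ν (Complex.I • pd a f) := by
  set κ := densityExponent (lower ν (Finsupp.single a 1))
  set h := op (MvPolynomial.monomial (symbolExponent ν) 1) f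
  have hcomm : op (MvPolynomial.monomial (symbolExponent ν) 1) (pd a f) = pd a h := by
    refine smul_right_injective _ Complex.I_ne_zero ?_
    simp only [h, ← op_X, ← map_smul, ← op_mul, mul_comm]
  have hparts := integral_pderiv_mul_eq_neg (X_dvd_dividedMonomial_add_single κ a)
    (f := h) (op_monomial_mem_expDecayingDerivs _ (by rwa [add_comm 1]))
  rw [pderiv_dividedMonomial_add_single, ← densityExponent_eq_lower_single_add ha] at hparts
  rw [pairing_smul, pairing, pairing, pairingIntegrand, pairingIntegrand,
    symbolExponent_lower_single_of_one_lt ha, LinearMap.comp_apply, LinearMap.comp_apply, hcomm,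
    LinearMap.mulLeft_apply, LinearMap.mulLeft_apply, hparts,
    densityExponent_eq_lower_single_add ha, map_add, Finsupp.degree_single]
  linear_combination (-Complex.I ^ (κ.degree + p) *
    ∫ s in orthant p, extend (MvPolynomial.aeval coord (dividedMonomial (κ + Finsupp.single a 1)) *
      pd a h) s) * Complex.I_mul_I

theorem pairing_lower (m : Fin p →₀ ℕ) {ν : Fin p → ℤ} {f : SchwingerAlgebra p}
    (hf : f ∈ expDecayingDerivs p ((symbolExponent ν).degree + m.degree)) :
    pairing (lower ν m) f = pairing ν (op (MvPolynomial.monomial m 1) f) := by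
  induction m using finsupp_induction_add_single_one generalizing f with
  | zero => rw [lower_zero, op_monomial_zero]
  | add_single_one m a hm =>
    rw [map_add, Finsupp.degree_single, ← add_assoc] at hf
    have hdf := (mem_expDecayingDerivs_succ.mp hf).2 a
    rw [lower_add, op_monomial_add, op_monomial_single_one,
      ← hm (Submodule.smul_mem _ Complex.I hdf)]
    rcases le_or_gt (lower ν m a) 1 with ha | ha
    · exact pairing_lower_single_of_le_one ha f
    · refine pairing_lower_single_of_one_lt ha (expDecayingDerivs_antitone ?_ hf)
      exact Nat.succ_le_succ (degree_symbolExponent_lower_le ν m)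

theorem applyLowering_pairing (B : MvPolynomial (Fin p) ℂ) {ν : Fin p → ℤ}
    {f : SchwingerAlgebra p}
    (hf : f ∈ expDecayingDerivs p ((symbolExponent ν).degree + B.totalDegree)) :
    applyLowering B (fun ν' => pairing ν' f) ν = pairing ν (op B f) := by
  have hmem (m : Fin p →₀ ℕ) (hm : m ∈ B.support) :
      f ∈ expDecayingDerivs p ((symbolExponent ν).degree + m.degree) := by
    have hle : m.degree ≤ B.totalDegree := by
      rw [Finsupp.degree_eq_sum, ← Finsupp.sum_fintype _ (fun _ k => k) (by simp)]
      exact MvPolynomial.le_totalDegree hm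
    exact expDecayingDerivs_antitone (Nat.add_le_add_left hle _) hf
  have hop : op B f = ∑ m ∈ B.support, B.coeff m • op (MvPolynomial.monomial m 1) f := by
    conv_lhs => rw [B.as_sum, map_sum, LinearMap.sum_apply]
    refine Finset.sum_congr rfl fun m _ => ?_
    rw [← LinearMap.smul_apply, ← map_smul, MvPolynomial.smul_monomial, smul_eq_mul, mul_one]
  rw [hop, pairing_sum _ _ fun m hm =>
    Submodule.smul_mem _ _ (op_monomial_mem_expDecayingDerivs m (hmem m hm))]
  refine Finset.sum_congr rfl fun m hm => ?_
  rw [pairing_smul, ← pairing_lower m (hmem m hm)]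
  rfl

end Pairing

section RegionOfConvergence

open smoothAlgebra SchwingerAlgebra

theorem prod_I_zpow_mul_I_pow {p : ℕ} (ν : Fin p → ℤ) :
    (∏ a, Complex.I ^ ν a) * Complex.I ^ (symbolExponent ν).degree =
      Complex.I ^ ((densityExponent ν).degree + p) := by
  have hp : Complex.I ^ p = ∏ _a : Fin p, Complex.I := by simp
  rw [pow_add, hp, Finsupp.degree_eq_sum, Finsupp.degree_eq_sum, ← Finset.prod_pow_eq_pow_sum,
    ← Finset.prod_pow_eq_pow_sum, ← Finset.prod_mul_distrib, ← Finset.prod_mul_distrib]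
  refine Finset.prod_congr rfl fun a _ => ?_
  rw [← zpow_natCast, ← zpow_natCast, ← zpow_add₀ Complex.I_ne_zero,
    ← zpow_add_one₀ Complex.I_ne_zero]
  congr 1
  simp only [symbolExponent, densityExponent, Finsupp.equivFunOnFinite_symm_apply_apply]
  omega

theorem eval_aeval_coord_dividedMonomial {p : ℕ} (m : Fin p →₀ ℕ) (s : openOrthant p) :
    eval s (MvPolynomial.aeval coord (dividedMonomial m)) =
      ∏ a, (s.1 a : ℂ) ^ m a / ((m a).factorial : ℂ) := by
  rw [dividedMonomial, MvPolynomial.aeval_monomial, map_mul, AlgHom.commutes,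
    Finsupp.prod_fintype _ _ fun a => pow_zero _, map_prod, Finset.prod_div_distrib, div_eq_inv_mul]
  simp only [map_pow, eval_coord]
  rfl

namespace CompleteFamily

variable {L n p : ℕ} (F : CompleteFamily L n p) (S : Matrix (Fin n) (Fin n) ℝ) {M : Fin p → ℂ}
  {η : ℝ} (ν : Fin p → ℤ) {D : ℂ}

variable (M D) in
theorem eqOn_schwingerIntegrand :
    Set.EqOn (F.schwingerIntegrand S M ν D)
      (Complex.I ^ (symbolExponent ν).degree •
        extend (pairingIntegrand ν (F.smoothModel S M (-D / 2)).E)) (orthant p) := by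
  intro s hs
  have hmixed := I_pow_mul_mixedPartial_eq_eval_op (symbolExponent ν)
    (fun s => (F.eval_E_smoothModel S M D s).symm) ⟨s, hs⟩
  have hsign : ∏ a, (-1 : ℂ) ^ (1 - ν a).toNat =
      Complex.I ^ (symbolExponent ν).degree * Complex.I ^ (symbolExponent ν).degree := by
    rw [← mul_pow, Complex.I_mul_I, Finsupp.degree_eq_sum, ← Finset.prod_pow_eq_pow_sum]
    rfl
  rw [Pi.smul_apply, smul_eq_mul, extend_coe _ (⟨s, hs⟩ : openOrthant p), pairingIntegrand,
    LinearMap.comp_apply, LinearMap.mulLeft_apply, map_mul, eval_aeval_coord_dividedMonomial,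
    ← hmixed, schwingerIntegrand, Finset.prod_mul_distrib, hsign]
  simp only [densityExponent, symbolExponent, Finsupp.equivFunOnFinite_symm_apply_apply,
    Finsupp.coe_equivFunOnFinite_symm]
  ring

variable (M D) in
theorem schwingerIntegral_eq_pairing :
    F.schwingerIntegral S M ν D = Complex.exp (-(Real.pi * Complex.I * L * D / 4)) *
      pairing ν (F.smoothModel S M (-D / 2)).E := by
  rw [schwingerIntegral, pairing, ← prod_I_zpow_mul_I_pow,
    setIntegral_congr_fun (measurableSet_orthant p) (F.eqOn_schwingerIntegrand S M ν D)]
  simp only [Pi.smul_apply, smul_eq_mul, integral_const_mul, mul_assoc]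

theorem integrableOn_schwingerIntegrand (hη : 0 < η) (hM : ∀ a, (M a).im = -η)
    (hD : ((2 * (symbolExponent ν).degree : ℕ) : ℝ) ≤ (-D / 2).re) :
    IntegrableOn (F.schwingerIntegrand S M ν D) (orthant p) :=
  IntegrableOn.congr_fun (Integrable.smul _ (integrableOn_extend
    (pairingIntegrand_mem_expDecaying (E_smoothModel_mem_expDecayingDerivs hη hM hD))))
    (F.eqOn_schwingerIntegrand S M ν D).symm (measurableSet_orthant p)

variable {S}

theorem applyLowering_schwingerIntegral (hS : S.IsSymm) (hG : S.det ≠ 0) (hη : 0 < η)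
    (hM : ∀ a, (M a).im = -η)
    (hD : ((2 * ((symbolExponent ν).degree + (F.baikovPoly S M).totalDegree) : ℕ) : ℝ) ≤
      (-D / 2).re) :
    (-2) ^ L * applyLowering (F.baikovPoly S M) (fun ν' => F.schwingerIntegral S M ν' D) ν =
      S.det * (ascPochhammer ℂ L).eval (D - ((L + n : ℕ) : ℂ) + 1) *
        F.schwingerIntegral S M ν (D + 2) := by
  set K := F.smoothModel S M (-D / 2)
  have hshift : K.E * K.G.det = (F.smoothModel S M (-(D + 2) / 2)).E := eval_ext fun s => by
    rw [F.eval_E_mul_det_G_smoothModel, F.eval_E_smoothModel]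
  have hpairing : applyLowering (F.baikovPoly S M) (fun ν' => pairing ν' K.E) ν =
      S.det * (Complex.I / 2) ^ L * (ascPochhammer ℂ L).eval (D - ((L + n : ℕ) : ℂ) + 1) *
        pairing ν (F.smoothModel S M (-(D + 2) / 2)).E := by
    rw [applyLowering_pairing _ (E_smoothModel_mem_expDecayingDerivs hη hM hD), ← hshift,
      ← pairing_smul, ← K.op_baikovPoly hS hG]
    rfl
  have hphase : Complex.exp (-(Real.pi * Complex.I * L * (D + 2) / 4)) =
      Complex.exp (-(Real.pi * Complex.I * L * D / 4)) * (-Complex.I) ^ L := by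
    rw [← Complex.exp_neg_pi_div_two_mul_I, ← Complex.exp_nat_mul, ← Complex.exp_add]
    ring_nf
  have hconst : (-2 : ℂ) ^ L * (Complex.I / 2) ^ L = (-Complex.I) ^ L := by
    rw [← mul_pow]
    ring_nf
  rw [schwingerIntegral_eq_pairing, hphase, ← hconst]
  simp only [schwingerIntegral_eq_pairing, applyLowering, mul_left_comm _ (Complex.exp _),
    ← Finset.mul_sum]
  rw [applyLowering] at hpairing
  linear_combination (-2) ^ L * Complex.exp (-(Real.pi * Complex.I * L * D / 4)) * hpairing

end CompleteFamily

end RegionOfConvergence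

section RaiseDim

variable {p : ℕ}

theorem mul_applyLowering (c : ℂ) (B : MvPolynomial (Fin p) ℂ) (I : (Fin p → ℤ) → ℂ)
    (ν : Fin p → ℤ) : c * applyLowering B I ν = applyLowering B (fun ν' => c * I ν') ν := by
  rw [applyLowering, applyLowering, Finset.mul_sum]
  exact Finset.sum_congr rfl fun m _ => mul_left_comm _ _ _

theorem applyLowering_map_evalRingHom (B : MvPolynomial (Fin p) (Polynomial ℂ)) (t : ℂ)
    (I : (Fin p → ℤ) → ℂ) (ν : Fin p → ℤ) :
    applyLowering (MvPolynomial.map (Polynomial.evalRingHom t) B) I ν =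
      ∑ m ∈ B.support, (B.coeff m).eval t * I (lower ν m) := by
  rw [applyLowering]
  simp only [MvPolynomial.coeff_map, Polynomial.coe_evalRingHom]
  refine Finset.sum_subset (MvPolynomial.support_map_subset _ _) fun m _ hm => ?_
  rw [MvPolynomial.notMem_support_iff, MvPolynomial.coeff_map, Polynomial.coe_evalRingHom] at hm
  rw [hm, zero_mul]

theorem tendsto_applyLowering_map_evalRingHom {ι : Type*} {l : Filter ι}
    (B : MvPolynomial (Fin p) (Polynomial ℂ)) {t : ι → ℂ} {t₀ : ℂ} (ht : Tendsto t l (𝓝 t₀))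
    {J : ι → (Fin p → ℤ) → ℂ} {I : (Fin p → ℤ) → ℂ} {ν : Fin p → ℤ}
    (hJ : ∀ m ∈ B.support, Tendsto (fun i => J i (lower ν m)) l (𝓝 (I (lower ν m)))) :
    Tendsto (fun i => applyLowering (MvPolynomial.map (Polynomial.evalRingHom (t i)) B) (J i) ν) l
      (𝓝 (applyLowering (MvPolynomial.map (Polynomial.evalRingHom t₀) B) I ν)) := by
  simp only [applyLowering_map_evalRingHom]
  exact tendsto_finsetSum _ fun m hm =>
    (((B.coeff m).continuous.tendsto t₀).comp ht).mul (hJ m hm)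

theorem lower_le (ν : Fin p → ℤ) (m : Fin p →₀ ℕ) : lower ν m ≤ ν :=
  fun _ => sub_le_self _ (Nat.cast_nonneg _)

theorem ascPochhammer_eval_ne_zero (L n : ℕ) {D : ℂ} (hD : D.re < 0) :
    (ascPochhammer ℂ L).eval (D - ((L + n : ℕ) : ℂ) + 1) ≠ 0 := by
  rw [Ne, ascPochhammer_eval_eq_zero_iff]
  rintro ⟨k, hk, h⟩
  have hre : (k : ℝ) = -(D.re - (L + n) + 1) := by simpa using congrArg Complex.re h
  have hkL : (k : ℝ) + 1 ≤ L := by exact_mod_cast hk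
  linarith [Nat.cast_nonneg (α := ℝ) n]

theorem analyticAt_ascPochhammer_eval (L : ℕ) (c D : ℂ) :
    AnalyticAt ℂ (fun D => (ascPochhammer ℂ L).eval (D - c + 1)) D := by
  simp only [← Polynomial.coe_aeval_eq_eval]
  exact AnalyticAt.aeval_polynomial (by fun_prop) _

theorem eventually_comap_re_atBot {P : ℂ → Prop} :
    (∀ᶠ D in comap Complex.re atBot, P D) ↔ ∃ R : ℝ, ∀ D : ℂ, D.re < R → P D := by
  simpa using (atBot_basis_Iio.comap Complex.re).eventually_iff (q := P)

namespace CompleteFamily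

variable {L n : ℕ} (F : CompleteFamily L n p) (S : Matrix (Fin n) (Fin n) ℝ) (M : Fin p → ℂ)

/-- The Baikov polynomial for the squared masses `M a - t`, with `t` as an indeterminate: lowering
all masses by `t` raises all inverse propagators by `t`. -/
def baikovFamily : MvPolynomial (Fin p) (Polynomial ℂ) :=
  MvPolynomial.aeval (fun a => MvPolynomial.X a + MvPolynomial.C Polynomial.X) (F.baikovPoly S M)

theorem map_evalRingHom_baikovFamily (t : ℂ) :
    MvPolynomial.map (Polynomial.evalRingHom t) (F.baikovFamily S M) =
      F.baikovPoly S (fun a => M a - t) := by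
  set φ : MvPolynomial (Fin p) ℂ →+* MvPolynomial (Fin p) ℂ :=
    (MvPolynomial.map (Polynomial.evalRingHom t)).comp
      (MvPolynomial.aeval fun a => MvPolynomial.X a + MvPolynomial.C Polynomial.X :
        MvPolynomial (Fin p) ℂ →ₐ[ℂ] MvPolynomial (Fin p) (Polynomial ℂ)) with hφ
  have hX (a : Fin p) : φ (MvPolynomial.X a) = MvPolynomial.X a + MvPolynomial.C t := by
    simp [hφ]
  have hC (c : ℂ) : φ (MvPolynomial.C c) = MvPolynomial.C c := by
    simp [hφ, MvPolynomial.algebraMap_apply]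
  have hdotPoly (e : DotIdx L n) : φ (F.dotPoly S M e) = F.dotPoly S (fun a => M a - t) e := by
    simp only [dotPoly, map_sum, map_mul, map_sub, hX, hC]
    refine Finset.sum_congr rfl fun a _ => ?_
    ring
  change φ (F.baikovPoly S M) = _
  rw [baikovPoly, baikovPoly, RingHom.map_det, RingHom.mapMatrix_apply, Matrix.fromBlocks_map]
  congr 2 <;> ext1 i j
  · exact hdotPoly _
  · exact hdotPoly _
  · exact hdotPoly _
  · exact hC _

variable {S M} in
theorem eventually_forall_mem_support_baikovPoly {ι : Type*} {l : Filter ι} {t : ι → ℂ}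
    {P : (Fin p →₀ ℕ) → ι → Prop} (hP : ∀ m, ∀ᶠ i in l, P m i) :
    ∀ᶠ i in l, ∀ m ∈ (F.baikovPoly S fun a => M a - t i).support, P m i := by
  filter_upwards [(eventually_all_finset (F.baikovFamily S M).support).mpr fun m _ => hP m]
    with i hi m hm
  rw [← map_evalRingHom_baikovFamily] at hm
  exact hi m (MvPolynomial.support_map_subset _ _ hm)

/-- The right-hand side of the dimensional recurrence, applied to the functions `J ν'` of the
dimension. -/
def raiseDim (J : (Fin p → ℤ) → ℂ → ℂ) (ν : Fin p → ℤ) (D : ℂ) : ℂ :=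
  (-2) ^ L / ((S.det : ℂ) * (ascPochhammer ℂ L).eval (D - ((L + n : ℕ) : ℂ) + 1)) *
    applyLowering (F.baikovPoly S M) (fun ν' => J ν' D) ν

variable {S M} {J : (Fin p → ℤ) → ℂ → ℂ} {ν : Fin p → ℤ}

theorem meromorphicAt_raiseDim {D : ℂ}
    (hJ : ∀ m ∈ (F.baikovPoly S M).support, MeromorphicAt (J (lower ν m)) D) :
    MeromorphicAt (F.raiseDim S M J ν) D :=
  ((MeromorphicAt.const _ D).div
    (analyticAt_const.mul (analyticAt_ascPochhammer_eval L _ D)).meromorphicAt).mul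
    (MeromorphicAt.fun_sum fun m hm => (MeromorphicAt.const _ D).mul (hJ m hm))

theorem analyticAt_raiseDim (hG : S.det ≠ 0) {D : ℂ}
    (hP : (ascPochhammer ℂ L).eval (D - ((L + n : ℕ) : ℂ) + 1) ≠ 0)
    (hJ : ∀ m ∈ (F.baikovPoly S M).support, AnalyticAt ℂ (J (lower ν m)) D) :
    AnalyticAt ℂ (F.raiseDim S M J ν) D :=
  (analyticAt_const.div (analyticAt_const.mul (analyticAt_ascPochhammer_eval L _ D))
    (mul_ne_zero (Complex.ofReal_ne_zero.mpr hG) hP)).mul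
    (Finset.analyticAt_fun_sum _ fun m hm => analyticAt_const.mul (hJ m hm))

theorem raiseDim_eq_schwingerIntegral (hS : S.IsSymm) (hG : S.det ≠ 0) {η : ℝ} (hη : 0 < η)
    (hM : ∀ a, (M a).im = -η) {D : ℂ} (hD : D.re < 0)
    (hN : ((2 * ((symbolExponent ν).degree + (F.baikovPoly S M).totalDegree) : ℕ) : ℝ) ≤
      (-D / 2).re)
    (hJ : ∀ m ∈ (F.baikovPoly S M).support,
      J (lower ν m) D = F.schwingerIntegral S M (lower ν m) D) :
    F.raiseDim S M J ν D = F.schwingerIntegral S M ν (D + 2) := by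
  have hne := mul_ne_zero (Complex.ofReal_ne_zero.mpr hG) (ascPochhammer_eval_ne_zero L n hD)
  have hcongr : applyLowering (F.baikovPoly S M) (fun ν' => J ν' D) ν =
      applyLowering (F.baikovPoly S M) (fun ν' => F.schwingerIntegral S M ν' D) ν :=
    Finset.sum_congr rfl fun m hm => congrArg _ (hJ m hm)
  rw [raiseDim, hcongr, div_mul_eq_mul_div, F.applyLowering_schwingerIntegral ν hS hG hη hM hN,
    mul_div_cancel_left₀ _ hne]

theorem isDimReg_raiseDim (hS : S.IsSymm) (hG : S.det ≠ 0) {η : ℝ} (hη : 0 < η)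
    (hM : ∀ a, (M a).im = -η)
    (hJ : ∀ m ∈ (F.baikovPoly S M).support, F.IsDimReg S M (lower ν m) (J (lower ν m))) :
    F.IsDimReg S M ν fun D => F.raiseDim S M J ν (D - 2) := by
  refine ⟨fun D => (F.meromorphicAt_raiseDim fun m hm => (hJ m hm).1 (D - 2)).comp_analyticAt
    (f := F.raiseDim S M J ν) (g := fun D => D - 2) (by fun_prop), ?_⟩
  have hJeq : ∀ᶠ D in comap Complex.re atBot, ∀ m ∈ (F.baikovPoly S M).support,
      J (lower ν m) D = F.schwingerIntegral S M (lower ν m) D :=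
    (eventually_all_finset _).mpr fun m hm =>
      (eventually_comap_re_atBot.mpr (hJ m hm).2).mono fun _ h => h.2
  obtain ⟨R, hR⟩ := eventually_comap_re_atBot.mp hJeq
  set N := 2 * ((symbolExponent ν).degree + (F.baikovPoly S M).totalDegree) with hN
  have hre (D : ℂ) : (-D / 2).re = -D.re / 2 := by simp
  refine ⟨min R (-2 * N), fun D hD => ?_⟩
  obtain ⟨hDR, hDN⟩ := lt_min_iff.mp hD
  have hre2 : (D - 2).re = D.re - 2 := by simp
  constructor
  · refine F.integrableOn_schwingerIntegrand S ν hη hM ?_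
    have hle : ((2 * (symbolExponent ν).degree : ℕ) : ℝ) ≤ N :=
      Nat.cast_le.mpr (Nat.mul_le_mul_left 2 (Nat.le_add_right _ _))
    rw [hre]
    linarith
  · have hrec := F.raiseDim_eq_schwingerIntegral hS hG hη hM (D := D - 2) (by linarith)
      (by rw [← hN, hre]; linarith) (hR (D - 2) (by linarith))
    rwa [sub_add_cancel] at hrec

theorem tendsto_mul_raiseDim {ι : Type*} {l : Filter ι} {t : ι → ℂ} (ht : Tendsto t l (𝓝 0))
    {c D : ℂ} {J : (Fin p → ℤ) → ι → ℂ → ℂ} {I : (Fin p → ℤ) → ℂ}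
    (hJ : ∀ ν' ≤ ν, Tendsto (fun i => c * J ν' i D) l (𝓝 (I ν'))) :
    Tendsto (fun i => c * F.raiseDim S (fun a => M a - t i) (fun ν' => J ν' i) ν D) l
      (𝓝 (F.raiseDim S M (fun ν' _ => I ν') ν D)) := by
  have h := tendsto_applyLowering_map_evalRingHom (F.baikovFamily S M) ht
    (J := fun i ν' => c * J ν' i D) fun m _ => hJ _ (lower_le ν m)
  simp only [map_evalRingHom_baikovFamily, sub_zero, ← mul_applyLowering] at h
  simpa only [raiseDim, mul_left_comm c] using h.const_mul _

end CompleteFamily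

end RaiseDim

end FeynmanIntegral

end

theorem mainTheorem6_general {L n p : ℕ} (F : FeynmanIntegral.CompleteFamily L n p)
    (S : Matrix (Fin n) (Fin n) ℝ) (hS : S.IsSymm) (hG : S.det ≠ 0) (m2 : Fin p → ℝ)
    (D₀ : ℕ) (ε D : ℂ) (hD : D = D₀ - 2 * ε)
    (hP : (ascPochhammer ℂ L).eval (D - ((L + n : ℕ) : ℂ) + 1) ≠ 0)
    (ν : Fin p → ℤ) (I : (Fin p → ℤ) → ℂ)
    (hI : ∀ ν' ≤ ν, F.HasValue S m2 ν' D₀ ε (I ν')) :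
    F.HasValue S m2 ν (D₀ + 2) ε
      ((-2) ^ L / ((S.det : ℂ) * (ascPochhammer ℂ L).eval (D - ((L + n : ℕ) : ℂ) + 1)) *
        FeynmanIntegral.applyLowering (F.baikovPoly S (fun a => (m2 a : ℂ))) I ν) := by
  choose! J hJ hlim using hI
  have hshift : ((D₀ + 2 : ℕ) : ℂ) - 2 * ε - 2 = D := by rw [hD]; push_cast; ring
  have hmass : Tendsto (fun η : ℝ => Complex.I * η) (𝓝[>] 0) (𝓝 0) := by
    have hcont : Continuous fun η : ℝ => Complex.I * η := by fun_prop
    exact (hcont.tendsto' 0 0 (by simp)).mono_left nhdsWithin_le_nhds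
  rw [← hD] at hJ hlim
  refine ⟨fun η D' => F.raiseDim S (fun a => m2 a - Complex.I * η) (fun ν' => J ν' η) ν (D' - 2),
    ?_, ?_⟩
  · filter_upwards [F.eventually_forall_mem_support_baikovPoly
      fun m => hJ _ (FeynmanIntegral.lower_le ν m), self_mem_nhdsWithin] with η hη hη0
    refine ⟨F.isDimReg_raiseDim hS hG hη0 (by simp) fun m hm => (hη m hm).1, ?_⟩
    refine AnalyticAt.fun_comp (g := F.raiseDim S _ _ ν) ?_ (by fun_prop)
    rw [hshift]
    exact F.analyticAt_raiseDim hG hP fun m hm => (hη m hm).2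
  · simp only [hshift]
    exact F.tendsto_mul_raiseDim hmass hlim

theorem mainTheorem6 {L n p : ℕ} (F : FeynmanIntegral.CompleteFamily L n p)
    (S : Matrix (Fin n) (Fin n) ℝ) (hS : S.IsSymm) (hG : S.det ≠ 0)
    (m2 : Fin p → ℝ) (hm : ∀ a, 0 < m2 a)
    (D₀ : ℕ) (ε D : ℂ) (hD : D = D₀ - 2 * ε)
    (hP : (ascPochhammer ℂ L).eval (D - ((L + n : ℕ) : ℂ) + 1) ≠ 0)
    (ν : Fin p → ℤ) (I : (Fin p → ℤ) → ℂ)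
    (hI : ∀ ν' ≤ ν, F.HasValue S m2 ν' D₀ ε (I ν')) :
    F.HasValue S m2 ν (D₀ + 2) ε
      ((-2) ^ L / ((S.det : ℂ) * (ascPochhammer ℂ L).eval (D - ((L + n : ℕ) : ℂ) + 1)) *
        FeynmanIntegral.applyLowering (F.baikovPoly S (fun a => (m2 a : ℂ))) I ν) := by
  exact mainTheorem6_general F S hS hG m2 D₀ ε D hD hP ν I hI
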